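/- Let $d\in\{2,3\}$, $t_0<T$, and let $\phi\in C^\infty(\mathbb R^d\times[t_0,T])$. For $t\in[t_0,T]$ put $\Omega(t)=\{x\in\mathbb R^d:\phi(x,t)<0\}$ and $\Gamma(t)=\{x\in\mathbb R^d:\phi(x,t)=0\}$, and let $$\mathcal Q=\bigcup_{t\in(t_0,T)}\Omega(t)\times\{t\},\qquad \Gamma_{\mathcal Q}=\bigcup_{t\in(t_0,T)}\Gamma(t)\times\{t\}.$$ Below, $\nabla$ and $\nabla^2$ denote the gradient and the Hessian with respect to $x$ only. Assume that all $\Omega(t)$, $t\in[t_0,T]$, are contained in a common ball, and that there is a point $(x_c,t_c)$, $t_c\in[t_0,T]$, with $$\phi(x_c,t_c)=0,\quad \nabla\phi(x_c,t_c)=0,\quad \det\nabla^2\phi(x_c,t_c)\neq0,\quad \partial_t\phi(x_c,t_c)\neq0,$$ and such that $\nabla\phi(x,t)\ne0$ for all $t\in[t_0,T]$ and $x\in\Gamma(t)$ with $(x,t)\neq(x_c,t_c)$. Assume that $t_c\in(t_0,T)$; if all eigenvalues of $\nabla^2\phi(x_c,t_c)$ are positive (creation or vanishing of an island, cases 2a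 and 3a), it is also allowed that $t_c=t_0$ and $\partial_t\phi(x_c,t_c)<0$, or that $t_c=T$ and $\partial_t\phi(x_c,t_c)>0$ (one-sided derivatives). Let $H$ be the space of all $u\in L^2(\mathcal Q)$ whose weak partial derivatives $\partial_iu$, $1\le i\le d$, with respect to the space variables exist in $L^2(\mathcal Q)$, with the norm $\|u\|_H=(\|u\|_{L^2(\mathcal Q)}^2+\|\nabla u\|_{L^2(\mathcal Q)}^2)^{1/2}$. Let $V_\Gamma=-\partial_t\phi/|\nabla\phi|$ and let $\omega=|t-t_c|^{1/2}(1+V_\Gamma^2)^{-1/2}$ on $\Gamma_{\mathcal Q}$ in the island cases 2a and 3a, $\omega=(1+V_\Gamma^2)^{-1/2}$ in all other cases. Let $H_0$ be the space of all $u\in H$ with trace zero on $\Gamma_{\mathcal Q}$, where the trace is the continuous extension to $H\to L^2_\omega(\Gamma_{\mathcal Q})$ of the restriction $w\mapsto w|_{\Gamma_{\mathcal Q}}$, $w\in C^\infty(\overline{\mathcal Q})$; that is, $u$ is the limit in $H$ of functions $w_n\in C^\infty(\overline{\mathcal Q})$ with $w_n|_{\Gamma_{\mathcal Q}}\to0$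 in $L^2_\omega(\Gamma_{\mathcal Q})$. Let $h\in C^\infty([0,\infty))$ satisfy $h=0$ on $[0,1)$, $h=1$ on $[3,\infty)$, $0\le h\le1$ and $|h'|\le1$, and for $\varepsilon>0$ let $\theta_\varepsilon=h(-\phi/\varepsilon)$ on $\mathcal Q$. **Lemma.** Suppose that the eigenvalues of $\nabla^2\phi(x_c,t_c)$ are not all negative (that is, cases 2c and 3d, the creation or vanishing of a hole for $d=2$ and of an interior void for $d=3$, are excluded). Then for every $u\in H_0$ one has $\theta_\varepsilon u\in H$ for all $\varepsilon>0$, $$\lim_{\varepsilon\to0^+}\|u-\theta_\varepsilon u\|_H=0,\qquad\text{and}\qquad \lim_{\varepsilon\to0^+}\|(\nabla\theta_\varepsilon)\,u\|_{L^2(\mathcal Q)}=0.$$ -/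

import Mathlib

open Filter MeasureTheory
open scoped Topology ContDiff ENNReal

namespace EvolvingDomain

/-- Points `(x, t)` of space-time `ℝ^d × ℝ`; the space variable carries the Euclidean norm. -/
abbrev SpaceTime (d : ℕ) : Type := EuclideanSpace ℝ (Fin d) × ℝ

/-- The spatial gradient `∇f (x, t)`, the time being kept fixed. -/
noncomputable def spaceGrad {d : ℕ} (f : SpaceTime d → ℝ) (q : SpaceTime d) :
    EuclideanSpace ℝ (Fin d) :=
  gradient (fun y => f (y, q.2)) q.1

/-- The spatial Hessian matrix `∇²f (x, t)`, with entries `∂ᵢ ∂ⱼ f`. -/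
noncomputable def spaceHess {d : ℕ} (f : SpaceTime d → ℝ) (q : SpaceTime d) :
    Matrix (Fin d) (Fin d) ℝ :=
  Matrix.of fun i j => spaceGrad (fun p => spaceGrad f p j) q i

/-- The time derivative `∂f/∂t (x, t)` of a function given for times in `[t₀, T]`
(one-sided at the two end points, the usual derivative in between). -/
noncomputable def timeDeriv {d : ℕ} (t₀ T : ℝ) (f : SpaceTime d → ℝ) (q : SpaceTime d) : ℝ :=
  derivWithin (fun s => f (q.1, s)) (Set.Icc t₀ T) q.2

/-- The domain `Ω(t) = {x | φ (x, t) < 0}`. -/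
def Omega {d : ℕ} (φ : SpaceTime d → ℝ) (t : ℝ) : Set (EuclideanSpace ℝ (Fin d)) :=
  {x | φ (x, t) < 0}

/-- The boundary `Γ(t) = {x | φ (x, t) = 0}`. -/
def Gam {d : ℕ} (φ : SpaceTime d → ℝ) (t : ℝ) : Set (EuclideanSpace ℝ (Fin d)) :=
  {x | φ (x, t) = 0}

/-- The space-time domain `𝒬 = ⋃_{t ∈ (t₀, T)} Ω(t) × {t}`. -/
def spaceTimeDomain {d : ℕ} (φ : SpaceTime d → ℝ) (t₀ T : ℝ) : Set (SpaceTime d) :=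
  {q | q.2 ∈ Set.Ioo t₀ T ∧ q.1 ∈ Omega φ q.2}

/-- The spatial boundary `Γ_𝒬 = ⋃_{t ∈ (t₀, T)} Γ(t) × {t}`. -/
def spatialBoundary {d : ℕ} (φ : SpaceTime d → ℝ) (t₀ T : ℝ) : Set (SpaceTime d) :=
  {q | q.2 ∈ Set.Ioo t₀ T ∧ q.1 ∈ Gam φ q.2}

/-! ### Critical points and their classification -/

/-- Cases 2a) and 3a) (creation or vanishing of an island): all eigenvalues of the spatial Hessian
at the critical point `c` are positive. -/
def IsIslandCase {d : ℕ} (φ : SpaceTime d → ℝ) (c : SpaceTime d) : Prop :=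
  ∀ l ∈ spectrum ℝ (spaceHess φ c), 0 < l

/-- Cases 2c) (creation or vanishing of a hole, `d = 2`) and 3d) (creation or vanishing of an
interior void, `d = 3`): all eigenvalues of the spatial Hessian at the critical point `c` are
negative. -/
def IsHoleOrVoidCase {d : ℕ} (φ : SpaceTime d → ℝ) (c : SpaceTime d) : Prop :=
  ∀ l ∈ spectrum ℝ (spaceHess φ c), l < 0

/-- The assumptions on the level set function `φ`, the time interval `[t₀, T]` and the critical
point `c = (x_c, t_c)`. -/
structure IsLevelSetEvolution {d : ℕ} (φ : SpaceTime d → ℝ) (t₀ T : ℝ) (c : SpaceTime d) :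
    Prop where
  /-- The time interval is nondegenerate. -/
  lt : t₀ < T
  /-- `φ ∈ C^∞(ℝ^d × [t₀, T])`. -/
  smooth : ContDiffOn ℝ ∞ φ (Set.univ ×ˢ Set.Icc t₀ T)
  /-- The domains `Ω(t)`, `t ∈ [t₀, T]`, lie in a common ball. -/
  bounded : ∃ R : ℝ, ∀ t ∈ Set.Icc t₀ T, ∀ x ∈ Omega φ t, ‖x‖ ≤ R
  /-- The critical point lies on the zero level ... -/
  zero_level : φ c = 0
  /-- ... is a critical point of `φ (·, t_c)` ... -/
  critical : spaceGrad φ c = 0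
  /-- ... the only one on the zero level ... -/
  isolated : ∀ t ∈ Set.Icc t₀ T, ∀ x ∈ Gam φ t, (x, t) ≠ c → spaceGrad φ (x, t) ≠ 0
  /-- ... is nondegenerate ... -/
  nondegenerate : (spaceHess φ c).det ≠ 0
  /-- ... and the time derivative of `φ` does not vanish there. -/
  timeDeriv_ne : timeDeriv t₀ T φ c ≠ 0
  /-- The critical time is an interior time; an island may also be created at the initial time
  or vanish at the final time. -/
  time : c.2 ∈ Set.Ioo t₀ T ∨
    (IsIslandCase φ c ∧ ((c.2 = t₀ ∧ timeDeriv t₀ T φ c < 0) ∨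
      (c.2 = T ∧ 0 < timeDeriv t₀ T φ c)))

/-! ### The anisotropic space `H` -/

/-- `g` is the weak spatial gradient of `u` on the open set `Q`:
`∫_Q u ∂ᵢξ = - ∫_Q gᵢ ξ` for all `ξ ∈ C_c^∞(Q)` and all `i`. -/
def IsWeakSpaceGrad {d : ℕ} (Q : Set (SpaceTime d)) (u : SpaceTime d → ℝ)
    (g : SpaceTime d → EuclideanSpace ℝ (Fin d)) : Prop :=
  ∀ ξ : SpaceTime d → ℝ, ContDiff ℝ ∞ ξ → HasCompactSupport ξ → tsupport ξ ⊆ Q →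
    ∀ i : Fin d, ∫ q in Q, u q * spaceGrad ξ q i = -∫ q in Q, g q i * ξ q

/-- `u` has a weak spatial gradient in `L²(Q)`. -/
def HasL2SpaceGrad {d : ℕ} (Q : Set (SpaceTime d)) (u : SpaceTime d → ℝ) : Prop :=
  ∃ g : SpaceTime d → EuclideanSpace ℝ (Fin d),
    MemLp g 2 (volume.restrict Q) ∧ IsWeakSpaceGrad Q u g

/-- `u ∈ H`: `u ∈ L²(Q)` with weak spatial partial derivatives in `L²(Q)`. -/
def MemH {d : ℕ} (Q : Set (SpaceTime d)) (u : SpaceTime d → ℝ) : Prop :=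
  MemLp u 2 (volume.restrict Q) ∧ HasL2SpaceGrad Q u

open Classical in
/-- The weak spatial gradient `∇u ∈ L²(Q)` (unique up to null sets; zero if there is none). -/
noncomputable def weakSpaceGrad {d : ℕ} (Q : Set (SpaceTime d)) (u : SpaceTime d → ℝ) :
    SpaceTime d → EuclideanSpace ℝ (Fin d) :=
  if h : HasL2SpaceGrad Q u then h.choose else 0

/-- The norm `‖u‖_H = (‖u‖²_{L²(Q)} + ‖∇u‖²_{L²(Q)})^{1/2}`, for `u ∈ H`. -/
noncomputable def hNorm {d : ℕ} (Q : Set (SpaceTime d)) (u : SpaceTime d → ℝ) : ℝ≥0∞ :=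
  (eLpNorm u 2 (volume.restrict Q) ^ 2 +
    eLpNorm (weakSpaceGrad Q u) 2 (volume.restrict Q) ^ 2) ^ (1 / 2 : ℝ)

/-! ### Traces on `Γ_𝒬` and the space `H₀` -/

/-- The `d`-dimensional Euclidean surface measure in `ℝ^d × ℝ` (the product is given its Euclidean
metric, not the maximum metric). -/
noncomputable def surfaceMeasure (d : ℕ) : Measure (SpaceTime d) :=
  (μHE[d] : Measure (WithLp 2 (EuclideanSpace ℝ (Fin d) × ℝ))).map WithLp.ofLp

/-- The normal velocity `V_Γ = - φ_t / |∇φ|` of `Γ(t)`. -/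
noncomputable def normalVelocity {d : ℕ} (φ : SpaceTime d → ℝ) (t₀ T : ℝ) (q : SpaceTime d) : ℝ :=
  -timeDeriv t₀ T φ q / ‖spaceGrad φ q‖

open Classical in
/-- The weight `ω = |t - t_c|^{1/2} (1 + V_Γ²)^{-1/2}` in the island cases and
`ω = (1 + V_Γ²)^{-1/2}` in all other cases. -/
noncomputable def traceWeight {d : ℕ} (φ : SpaceTime d → ℝ) (t₀ T : ℝ) (c : SpaceTime d)
    (q : SpaceTime d) : ℝ :=
  (if IsIslandCase φ c then √|q.2 - c.2| else 1) * (√(1 + normalVelocity φ t₀ T q ^ 2))⁻¹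

/-- The norm of `L²_ω(Γ_𝒬)`. -/
noncomputable def traceNorm {d : ℕ} (φ : SpaceTime d → ℝ) (t₀ T : ℝ) (c : SpaceTime d)
    (g : SpaceTime d → ℝ) : ℝ≥0∞ :=
  (∫⁻ q in spatialBoundary φ t₀ T, ENNReal.ofReal (traceWeight φ t₀ T c q * g q ^ 2)
    ∂(surfaceMeasure d)) ^ (1 / 2 : ℝ)

/-- `g` is the trace of `u ∈ H` on `Γ_𝒬`. The trace operator is the extension by continuity of the
restriction `w ↦ w|_{Γ_𝒬}` from `C^∞(closure 𝒬)` to `H → L²_ω(Γ_𝒬)`; so `g` is the limit in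
`L²_ω(Γ_𝒬)` of the restrictions of smooth functions that converge to `u` in `H`. -/
def HasTrace {d : ℕ} (φ : SpaceTime d → ℝ) (t₀ T : ℝ) (c : SpaceTime d)
    (u g : SpaceTime d → ℝ) : Prop :=
  ∃ w : ℕ → SpaceTime d → ℝ, (∀ n, ContDiff ℝ ∞ (w n)) ∧
    (∀ n, MemH (spaceTimeDomain φ t₀ T) (w n)) ∧
    Tendsto (fun n => hNorm (spaceTimeDomain φ t₀ T) (u - w n)) atTop (𝓝 0) ∧
    Tendsto (fun n => traceNorm φ t₀ T c (w n - g)) atTop (𝓝 0)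

/-- `u ∈ H₀`: `u ∈ H` and the trace of `u` on `Γ_𝒬` vanishes. -/
def MemH₀ {d : ℕ} (φ : SpaceTime d → ℝ) (t₀ T : ℝ) (c : SpaceTime d) (u : SpaceTime d → ℝ) :
    Prop :=
  MemH (spaceTimeDomain φ t₀ T) u ∧ HasTrace φ t₀ T c u 0

/-! ### The level-set cut-off -/

/-- The cut-off profiles: `h ∈ C^∞([0, ∞))`, `h = 0` on `[0, 1)`, `h = 1` on `[3, ∞)`,
`0 ≤ h ≤ 1` and `|h'| ≤ 1`. -/
structure IsCutoffProfile (h : ℝ → ℝ) : Prop where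
  smooth : ContDiffOn ℝ ∞ h (Set.Ici 0)
  eq_zero : ∀ r ∈ Set.Ico (0 : ℝ) 1, h r = 0
  eq_one : ∀ r ∈ Set.Ici (3 : ℝ), h r = 1
  mem_Icc : ∀ r ∈ Set.Ici (0 : ℝ), h r ∈ Set.Icc (0 : ℝ) 1
  abs_deriv_le : ∀ r ∈ Set.Ici (0 : ℝ), |derivWithin h (Set.Ici 0) r| ≤ 1

/-- The cut-off function `θ_ε = h(-φ / ε)`. -/
noncomputable def theta {d : ℕ} (h : ℝ → ℝ) (φ : SpaceTime d → ℝ) (ε : ℝ) (q : SpaceTime d) : ℝ :=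
  h (-φ q / ε)

end EvolvingDomain

/-! The statement rests on a Hardy inequality: `u ∇φ / φ` is square integrable over `𝒬` for every `u
∈ H₀` (`lintegral_hardyWeight_lt_top`). Since `h'(-φ/ε)` vanishes when `-φ > 3ε`, one has `|∇θ_ε| ≤
3|∇φ|/|φ|` uniformly in `ε` (`enorm_smul_spaceGrad_theta_sq_le`). At each point of `𝒬` the gradient
of `θ_ε` is zero for small `ε`, so dominated convergence gives `u ∇θ_ε → 0` in `L²`. The remaining
terms `(1 - θ_ε) u` and `(1 - θ_ε) ∇u` also tend to zero by dominated convergence.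

For the Hardy inequality, integrate the spatial divergence of `w² A∇φ / (η - φ)`, cut off near the
zero level at scale `δ`, where `A = v vᵀ + a I` is a constant positive definite matrix. The main
term is `(A∇φ·∇φ) w² / (η - φ)²`. The dangerous term is `div(A∇φ) w² / (η - φ)`, which is harmless
where the divergence is nonnegative. Some eigenvalue of the Hessian at the critical point `c` is
positive. With `v` an eigenvector for it and `a` small, `div(A∇φ) > 0` at `c`, the only point where
`φ` and `∇φ` vanish together. By compactness the negative part of the divergence is at most `C(|∇φ|²
+ |φ|)`, and both contributions can be absorbed (`exists_hardy_energy`). A negative definite Hessian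
admits no such `A`.

The cut-off leaves an error of the form `(C'/δ) ∫ w²` over the layer `{-δ ≤ φ < 0}`. Only space
derivatives occur, so times closer than `κ` to the critical time can be discarded. On the rest the
zero level is regular and the layer integral is controlled by `δ` times the weighted trace integral
(`exists_lintegral_tube_le`). Letting `δ → 0` gives `exists_hardy_smooth`. There the constant of the
energy term does not depend on `η` and `κ`, while that of the trace term may.

Now fix `η` and `κ` and insert smooth `w_n → u` whose traces tend to zero. The trace term
disappears, whatever its constant, and a bound uniform in `η` and `κ` remains
(`exists_regularized_hardy`). Fatou's lemma with `η = κ → 0` finishes the argument. -/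

namespace EvolvingDomain

/-! ### Space derivatives on the closed time slab -/

section

variable {d : ℕ}

/-- The derivative of `f` in the space direction `e`, the time being kept fixed. -/
noncomputable def dirD (e : EuclideanSpace ℝ (Fin d)) (f : SpaceTime d → ℝ)
    (q : SpaceTime d) : ℝ :=
  fderiv ℝ (fun y => f (y, q.2)) q.1 e

/-- The standard basis vectors of space. -/
noncomputable abbrev stdVec (i : Fin d) : EuclideanSpace ℝ (Fin d) := EuclideanSpace.single i 1

lemma spaceGrad_apply (f : SpaceTime d → ℝ) (q : SpaceTime d) (i : Fin d) :
    spaceGrad f q i = dirD (stdVec i) f q := by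
  have h1 : inner ℝ (spaceGrad f q) (stdVec i) = dirD (stdVec i) f q := by
    simp only [spaceGrad, gradient, dirD]
    exact InnerProductSpace.toDual_symm_apply
  rw [← h1, stdVec, EuclideanSpace.inner_single_right]
  simp

lemma vec_eq_sum (v : EuclideanSpace ℝ (Fin d)) : v = ∑ i, v i • stdVec i := by
  ext j
  simp [stdVec, Finset.sum_apply, Pi.single_apply]

lemma dirD_eq_sum (v : EuclideanSpace ℝ (Fin d)) (f : SpaceTime d → ℝ) (q : SpaceTime d) :
    dirD v f q = ∑ i, v i * dirD (stdVec i) f q := by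
  unfold dirD
  conv_lhs => rw [vec_eq_sum v]
  simp only [map_sum, map_smul, smul_eq_mul]

lemma norm_spaceGrad_sq (f : SpaceTime d → ℝ) (q : SpaceTime d) :
    ‖spaceGrad f q‖ ^ 2 = ∑ i, dirD (stdVec i) f q ^ 2 := by
  rw [EuclideanSpace.norm_sq_eq]
  simp [spaceGrad_apply]

lemma spaceGrad_eq_toLp (f : SpaceTime d → ℝ) (q : SpaceTime d) :
    spaceGrad f q = WithLp.toLp 2 (fun i => dirD (stdVec i) f q) := by
  ext i
  simp [spaceGrad_apply]

lemma hasFDerivAt_mk_left (x : EuclideanSpace ℝ (Fin d)) (t : ℝ) :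
    HasFDerivAt (fun y : EuclideanSpace ℝ (Fin d) => ((y, t) : SpaceTime d))
      (ContinuousLinearMap.inl ℝ _ ℝ) x :=
  hasFDerivAt_prodMk_left x t

lemma uniqueDiffOn_slab {t₀ T : ℝ} (h : t₀ < T) :
    UniqueDiffOn ℝ ((Set.univ : Set (EuclideanSpace ℝ (Fin d))) ×ˢ Set.Icc t₀ T) :=
  uniqueDiffOn_univ.prod (uniqueDiffOn_Icc h)

lemma slice_contDiff {t₀ T : ℝ} {f : SpaceTime d → ℝ}
    (hf : ContDiffOn ℝ ∞ f (Set.univ ×ˢ Set.Icc t₀ T)) {t : ℝ} (ht : t ∈ Set.Icc t₀ T) :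
    ContDiff ℝ ∞ (fun y : EuclideanSpace ℝ (Fin d) => f (y, t)) := by
  rw [← contDiffOn_univ]
  refine hf.comp (contDiff_id.prodMk contDiff_const).contDiffOn ?_
  intro y _
  exact ⟨trivial, ht⟩

/-- As `φ` is smooth only on the closed slab, slice derivatives are read off the derivative within
the slab. This makes them smooth up to `t₀` and `T`, as the compactness arguments below require. -/
lemma dirD_eq_fderivWithin {t₀ T : ℝ} {f : SpaceTime d → ℝ}
    (hf : ContDiffOn ℝ ∞ f (Set.univ ×ˢ Set.Icc t₀ T)) (e : EuclideanSpace ℝ (Fin d))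
    {q : SpaceTime d} (hq : q.2 ∈ Set.Icc t₀ T) :
    dirD e f q = fderivWithin ℝ f (Set.univ ×ˢ Set.Icc t₀ T) q (e, 0) := by
  have h1 : HasFDerivWithinAt f (fderivWithin ℝ f (Set.univ ×ˢ Set.Icc t₀ T) q)
      (Set.univ ×ˢ Set.Icc t₀ T) (q.1, q.2) :=
    ((hf.differentiableOn (by simp)) q ⟨trivial, hq⟩).hasFDerivWithinAt
  have h2 := h1.comp q.1 ((hasFDerivAt_mk_left q.1 q.2).hasFDerivWithinAt (s := Set.univ))
    (t := Set.univ ×ˢ Set.Icc t₀ T) (fun y _ => (⟨trivial, hq⟩ : (y, q.2) ∈ Set.univ ×ˢ Set.Icc t₀ T))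
  rw [hasFDerivWithinAt_univ] at h2
  unfold dirD
  rw [show (fun y => f (y, q.2)) = f ∘ fun y => (y, q.2) from rfl, h2.fderiv]
  simp

lemma dirD_contDiffOn {t₀ T : ℝ} (h : t₀ < T) {f : SpaceTime d → ℝ}
    (hf : ContDiffOn ℝ ∞ f (Set.univ ×ˢ Set.Icc t₀ T)) (e : EuclideanSpace ℝ (Fin d)) :
    ContDiffOn ℝ ∞ (dirD e f) (Set.univ ×ˢ Set.Icc t₀ T) := by
  have h1 := hf.fderivWithin (m := ∞) (uniqueDiffOn_slab h) (by simp)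
  have h2 := h1.clm_apply (contDiffOn_const (c := ((e, 0) : SpaceTime d)))
  exact h2.congr fun q hq => dirD_eq_fderivWithin hf e hq.2

lemma timeDeriv_eq_fderivWithin {t₀ T : ℝ} (h : t₀ < T) {f : SpaceTime d → ℝ}
    (hf : ContDiffOn ℝ ∞ f (Set.univ ×ˢ Set.Icc t₀ T))
    {q : SpaceTime d} (hq : q.2 ∈ Set.Icc t₀ T) :
    timeDeriv t₀ T f q = fderivWithin ℝ f (Set.univ ×ˢ Set.Icc t₀ T) q (0, 1) := by
  have h1 : HasFDerivWithinAt f (fderivWithin ℝ f (Set.univ ×ˢ Set.Icc t₀ T) q)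
      (Set.univ ×ˢ Set.Icc t₀ T) (q.1, q.2) :=
    ((hf.differentiableOn (by simp)) q ⟨trivial, hq⟩).hasFDerivWithinAt
  have h2 := h1.comp_hasDerivWithinAt q.2 (s := Set.Icc t₀ T)
    (f := fun s => ((q.1, s) : SpaceTime d)) (f' := (0, 1))
    ((hasDerivWithinAt_const _ _ _).prodMk (hasDerivWithinAt_id _ _))
    (fun y hy => ⟨trivial, hy⟩)
  unfold timeDeriv
  exact h2.derivWithin (uniqueDiffOn_Icc h _ hq)

lemma timeDeriv_continuousOn {t₀ T : ℝ} (h : t₀ < T) {f : SpaceTime d → ℝ}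
    (hf : ContDiffOn ℝ ∞ f (Set.univ ×ˢ Set.Icc t₀ T)) :
    ContinuousOn (timeDeriv t₀ T f) (Set.univ ×ˢ Set.Icc t₀ T) := by
  have h1 := hf.fderivWithin (m := ∞) (uniqueDiffOn_slab h) (by simp)
  have h2 := h1.clm_apply (contDiffOn_const (c := ((0, 1) : SpaceTime d)))
  exact (h2.congr fun q hq => timeDeriv_eq_fderivWithin h hf hq.2).continuousOn

lemma dirD_contDiff {f : SpaceTime d → ℝ} (hf : ContDiff ℝ ∞ f)
    (e : EuclideanSpace ℝ (Fin d)) : ContDiff ℝ ∞ (dirD e f) := by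
  have h1 : ContDiff ℝ ∞ (fderiv ℝ f) := hf.fderiv_right (by simp)
  have h2 := h1.clm_apply (contDiff_const (c := ((e, 0) : SpaceTime d)))
  convert h2 using 1
  ext q
  have h3 : HasFDerivAt f (fderiv ℝ f q) (q.1, q.2) :=
    ((hf.differentiable (by simp)) q).hasFDerivAt
  have h4 := h3.comp q.1 (hasFDerivAt_mk_left q.1 q.2)
  unfold dirD
  rw [show (fun y => f (y, q.2)) = f ∘ fun y => (y, q.2) from rfl, h4.fderiv]
  simp

lemma hasLineDerivAt_dirD {f : SpaceTime d → ℝ} {q : SpaceTime d}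
    (hf : DifferentiableAt ℝ (fun y => f (y, q.2)) q.1) (e : EuclideanSpace ℝ (Fin d)) :
    HasLineDerivAt ℝ f (dirD e f q) q (e, 0) := by
  have := hf.hasFDerivAt.hasLineDerivAt e
  unfold HasLineDerivAt at this ⊢
  unfold dirD
  convert this using 2
  simp [Prod.add_def]

/-- Both sides are bilinear expansions in the coordinates of `v`, so symmetry of the Hessian plays
no role. -/
lemma dirD_dirD_eq_sum {t₀ T : ℝ} (h : t₀ < T) {f : SpaceTime d → ℝ}
    (hf : ContDiffOn ℝ ∞ f (Set.univ ×ˢ Set.Icc t₀ T)) (v : EuclideanSpace ℝ (Fin d))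
    {q : SpaceTime d} (hq : q.2 ∈ Set.Icc t₀ T) :
    dirD v (dirD v f) q = ∑ i, ∑ j, v i * v j * spaceHess f q i j := by
  have h1 : dirD v f = fun q => ∑ j, v j * dirD (stdVec j) f q := by
    ext q; exact dirD_eq_sum v f q
  have h2 : ∀ e, dirD e (dirD v f) q = ∑ j, v j * dirD e (dirD (stdVec j) f) q := by
    intro e
    rw [h1]
    unfold dirD
    have hd : ∀ j ∈ (Finset.univ : Finset (Fin d)), DifferentiableAt ℝ
        (fun y => v j * dirD (stdVec j) f (y, q.2)) q.1 := fun j _ =>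
      (((slice_contDiff (dirD_contDiffOn h hf (stdVec j)) hq).differentiable
        (by simp)) q.1).const_mul _
    have := fderiv_fun_sum hd
    unfold dirD at this
    rw [this]
    rw [sum_apply]
    refine Finset.sum_congr rfl fun j _ => ?_
    have h3 := ((slice_contDiff (dirD_contDiffOn h hf (stdVec j)) hq).differentiable
        (by simp)) q.1
    have := fderiv_const_mul h3 (v j)
    unfold dirD at this
    rw [this]
    simp
  rw [dirD_eq_sum]
  refine Finset.sum_congr rfl fun i _ => ?_
  rw [h2, Finset.mul_sum]
  refine Finset.sum_congr rfl fun j _ => ?_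
  have : spaceHess f q i j = dirD (stdVec i) (dirD (stdVec j) f) q := by
    unfold spaceHess
    rw [Matrix.of_apply, spaceGrad_apply]
    congr 1
    ext p
    exact spaceGrad_apply f p j
  rw [this]; ring

lemma dirD_stdVec_dirD_stdVec {t₀ T : ℝ} (h : t₀ < T) {f : SpaceTime d → ℝ}
    (hf : ContDiffOn ℝ ∞ f (Set.univ ×ˢ Set.Icc t₀ T)) (k : Fin d)
    {q : SpaceTime d} (hq : q.2 ∈ Set.Icc t₀ T) :
    dirD (stdVec k) (dirD (stdVec k) f) q = spaceHess f q k k := by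
  rw [dirD_dirD_eq_sum h hf _ hq]
  simp [stdVec]

end

/-! ### Compactness, the regularized reciprocal and the pointwise Hardy estimate -/

section

variable {d : ℕ}

/-- Near a zero of `g` the function `f` is negative and `C = 0` works. Near any other point `g` is
bounded below and `f` above. Because `g ≥ 0`, local constants may be added when neighbourhoods are
united. -/
lemma exists_le_mul_of_isCompact {X : Type*} [TopologicalSpace X] {K : Set X}
    (hK : IsCompact K) {f g : X → ℝ} (hf : ContinuousOn f K) (hg : ContinuousOn g K)
    (hg0 : ∀ x ∈ K, 0 ≤ g x) (hfg : ∀ x ∈ K, g x = 0 → f x < 0) :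
    ∃ C : ℝ, 0 ≤ C ∧ ∀ x ∈ K, f x ≤ C * g x := by
  have hcov : ∀ x ∈ K, ∃ t ∈ 𝓝[K] x, ∃ C : ℝ, 0 ≤ C ∧ ∀ y ∈ t, y ∈ K → f y ≤ C * g y := by
    intro x hx
    rcases (hg0 x hx).eq_or_lt with h0 | h0
    · refine ⟨{y | f y < 0}, hf x hx (Iio_mem_nhds (hfg x hx h0.symm)), 0, le_rfl, ?_⟩
      intro y hy _
      simpa using le_of_lt hy
    · refine ⟨{y | f y < f x + 1} ∩ {y | g x / 2 < g y},
        inter_mem (hf x hx (Iio_mem_nhds (by linarith))) (hg x hx (Ioi_mem_nhds (by linarith))),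
        (|f x| + 1) / (g x / 2), by positivity, ?_⟩
      rintro y ⟨hy1, hy2⟩ _
      simp only [Set.mem_ofPred_eq] at hy1 hy2
      calc f y ≤ |f x| + 1 := by linarith [le_abs_self (f x)]
        _ = (|f x| + 1) / (g x / 2) * (g x / 2) := by field_simp
        _ ≤ _ := by gcongr
  have := hK.induction_on (p := fun t => ∃ C : ℝ, 0 ≤ C ∧ ∀ y ∈ t, y ∈ K → f y ≤ C * g y)
    ⟨0, le_rfl, by simp⟩ (fun s t hst ⟨C, h0, h⟩ => ⟨C, h0, fun y hy => h y (hst hy)⟩)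
    (fun s t ⟨C, h0, h⟩ ⟨D, h0', h'⟩ => ⟨C + D, by positivity, by
      rintro y (hy | hy) hyK
      · nlinarith [h y hy hyK, hg0 y hyK, mul_nonneg h0' (hg0 y hyK)]
      · nlinarith [h' y hy hyK, hg0 y hyK, mul_nonneg h0 (hg0 y hyK)]⟩) hcov
  obtain ⟨C, h0, h⟩ := this
  exact ⟨C, h0, fun x hx => h x hx hx⟩

/-- The regularized reciprocal `s ↦ χ(-s/δ) / (η - s)` with a smooth step `χ`. -/
noncomputable def cutRecip (η δ s : ℝ) : ℝ := Real.smoothTransition (-s / δ) * (η - s)⁻¹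

/-- The derivative of `cutRecip`. -/
noncomputable def cutRecipDeriv (η δ s : ℝ) : ℝ :=
  Real.smoothTransition (-s / δ) * ((η - s)⁻¹) ^ 2 -
    deriv Real.smoothTransition (-s / δ) / δ * (η - s)⁻¹

/-- The value `0` is the global minimum of the step, so this covers the end point `0` as well. -/
lemma deriv_smoothTransition_of_nonpos {s : ℝ} (hs : s ≤ 0) :
    deriv Real.smoothTransition s = 0 := by
  apply IsLocalMin.deriv_eq_zero
  refine Eventually.of_forall fun y => ?_
  rw [Real.smoothTransition.zero_of_nonpos hs]
  exact Real.smoothTransition.nonneg y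

lemma deriv_smoothTransition_of_one_le {s : ℝ} (hs : 1 ≤ s) :
    deriv Real.smoothTransition s = 0 := by
  apply IsLocalMax.deriv_eq_zero
  refine Eventually.of_forall fun y => ?_
  rw [Real.smoothTransition.one_of_one_le hs]
  exact Real.smoothTransition.le_one y

lemma continuous_deriv_smoothTransition : Continuous (deriv Real.smoothTransition) :=
  (Real.smoothTransition.contDiff (n := 1)).continuous_deriv (by simp)

lemma exists_abs_deriv_smoothTransition_le :
    ∃ L : ℝ, 0 ≤ L ∧ ∀ s, |deriv Real.smoothTransition s| ≤ L := by
  obtain ⟨L, hL⟩ := (isCompact_Icc (a := (0 : ℝ)) (b := 1)).exists_bound_of_continuousOn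
    continuous_deriv_smoothTransition.continuousOn
  have h0 : 0 ≤ L := (norm_nonneg _).trans (hL 0 (by simp))
  refine ⟨L, h0, fun s => ?_⟩
  rcases le_total s 0 with h | h
  · simpa [deriv_smoothTransition_of_nonpos h] using h0
  rcases le_total 1 s with h' | h'
  · simpa [deriv_smoothTransition_of_one_le h'] using h0
  · exact hL s ⟨h, h'⟩

/-- The pole at `η` is invisible because the step vanishes on all of `s ≥ 0`. Hence the function is
differentiable on the whole line, and composition with `φ` extends by zero across the boundary. -/
lemma hasDerivAt_cutRecip {η δ : ℝ} (hη : 0 < η) (hδ : 0 < δ) (s : ℝ) :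
    HasDerivAt (cutRecip η δ) (cutRecipDeriv η δ s) s := by
  rcases lt_or_ge s η with h | h
  · have h1 : HasDerivAt (fun s : ℝ => -s / δ) (-1 / δ) s :=
      ((hasDerivAt_id s).neg).div_const δ
    have h2 : HasDerivAt (fun s : ℝ => Real.smoothTransition (-s / δ))
        (deriv Real.smoothTransition (-s / δ) * (-1 / δ)) s :=
      HasDerivAt.comp s (h₂ := Real.smoothTransition) (h := fun s : ℝ => -s / δ)
      (((Real.smoothTransition.contDiff (n := 1)).differentiable (by simp)
        (-s / δ)).hasDerivAt) h1
    have hne : η - s ≠ 0 := by linarith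
    have h3 : HasDerivAt (fun s : ℝ => (η - s)⁻¹) (-(-1) / (η - s) ^ 2) s :=
      ((hasDerivAt_id s).const_sub η).inv hne
    have h4 := h2.mul h3
    unfold cutRecip cutRecipDeriv
    refine h4.congr_deriv ?_
    rw [inv_pow]
    ring
  · have hs : -s / δ ≤ 0 := div_nonpos_of_nonpos_of_nonneg (by linarith) hδ.le
    have h1 : cutRecipDeriv η δ s = 0 := by
      unfold cutRecipDeriv
      rw [Real.smoothTransition.zero_of_nonpos hs, deriv_smoothTransition_of_nonpos hs]
      simp
    rw [h1]
    refine (hasDerivAt_const s (0 : ℝ)).congr_of_eventuallyEq ?_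
    filter_upwards [lt_mem_nhds (show 0 < s by linarith)] with y hy
    unfold cutRecip
    rw [Real.smoothTransition.zero_of_nonpos
      (div_nonpos_of_nonpos_of_nonneg (by linarith) hδ.le), zero_mul]

lemma cutRecip_of_nonneg {η δ s : ℝ} (hδ : 0 < δ) (hs : 0 ≤ s) : cutRecip η δ s = 0 := by
  unfold cutRecip
  rw [Real.smoothTransition.zero_of_nonpos
      (div_nonpos_of_nonpos_of_nonneg (by linarith) hδ.le), zero_mul]

lemma cutRecipDeriv_of_nonneg {η δ s : ℝ} (hδ : 0 < δ) (hs : 0 ≤ s) :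
    cutRecipDeriv η δ s = 0 := by
  have hs : -s / δ ≤ 0 := div_nonpos_of_nonpos_of_nonneg (by linarith) hδ.le
  unfold cutRecipDeriv
  rw [Real.smoothTransition.zero_of_nonpos hs, deriv_smoothTransition_of_nonpos hs]
  simp

lemma continuousOn_cutRecip {η δ : ℝ} (hη : 0 < η) :
    ContinuousOn (cutRecip η δ) (Set.Iic 0) := by
  unfold cutRecip
  refine ContinuousOn.mul ?_ ?_
  · exact (Real.smoothTransition.continuous.comp (by fun_prop)).continuousOn
  · exact ContinuousOn.inv₀ (by fun_prop) fun s hs => by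
      simp only [Set.mem_Iic] at hs; linarith

lemma continuousOn_cutRecipDeriv {η δ : ℝ} (hη : 0 < η) :
    ContinuousOn (cutRecipDeriv η δ) (Set.Iic 0) := by
  unfold cutRecipDeriv
  have h1 : ContinuousOn (fun s : ℝ => (η - s)⁻¹) (Set.Iic 0) :=
    ContinuousOn.inv₀ (by fun_prop) fun s hs => by
      simp only [Set.mem_Iic] at hs; linarith
  refine ContinuousOn.sub (ContinuousOn.mul ?_ (h1.pow 2)) (ContinuousOn.mul ?_ h1)
  · exact (Real.smoothTransition.continuous.comp (by fun_prop)).continuousOn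
  · exact ((continuous_deriv_smoothTransition.comp
      (show Continuous fun s : ℝ => -s / δ by fun_prop)).div_const δ).continuousOn

/-- With `p = ψ⁻¹`, the `Sd` terms cancel and it remains to absorb `p(L w² + 2wB)` in half of `G w²
p²`. Two applications of Young's inequality spend a quarter each: one on `(C/a) G p w²`, which comes
from the lower bound for `L`, and one on `2pwB`, using `B² ≤ G W`. The part `C ψ` of the bound for
`-L` cancels the factor `p` exactly. -/
lemma hardy_pointwise {S Sd ψ G W B L w a M C : ℝ} (hS : 0 ≤ S) (hψ : 0 < ψ)
    (hG : 0 ≤ G) (hGM : G ≤ M) (ha : 0 < a) (hL : -L ≤ C * (G / a + ψ))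
    (hW : 0 ≤ W) (hB : B ^ 2 ≤ G * W) :
    S * (G * w ^ 2 * ψ⁻¹ ^ 2) / 2 ≤
      (S * ψ⁻¹ ^ 2 - Sd * ψ⁻¹) * (G * w ^ 2) + S * ψ⁻¹ * (L * w ^ 2 + 2 * w * B) +
      S * ((C + (C / a) ^ 2 * M) * w ^ 2 + 4 * W) + Sd * ψ⁻¹ * (G * w ^ 2) := by
  set p := ψ⁻¹ with hp
  have hpψ : p * ψ = 1 := inv_mul_cancel₀ hψ.ne'
  have hp0 : 0 < p := inv_pos.2 hψ
  have h1 : -(p * L * w ^ 2) ≤ C / a * G * p * w ^ 2 + C * w ^ 2 := by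
    have := mul_le_mul_of_nonneg_left hL (mul_nonneg hp0.le (sq_nonneg w))
    calc -(p * L * w ^ 2) = p * w ^ 2 * -L := by ring
      _ ≤ _ := this
      _ = C / a * G * p * w ^ 2 + C * w ^ 2 * (p * ψ) := by field_simp
      _ = _ := by rw [hpψ]; ring
  have h2 : C / a * G * p * w ^ 2 ≤ G * w ^ 2 * p ^ 2 / 4 + (C / a) ^ 2 * M * w ^ 2 := by
    have h3 : 0 ≤ G * w ^ 2 * (p / 2 - C / a) ^ 2 := by positivity
    have h4 : (C / a) ^ 2 * w ^ 2 * G ≤ (C / a) ^ 2 * w ^ 2 * M := by gcongr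
    nlinarith
  have h5 : -(2 * p * w * B) ≤ G * w ^ 2 * p ^ 2 / 4 + 4 * W := by
    have h6 : (2 * p * w * B) ^ 2 ≤ (G * w ^ 2 * p ^ 2 / 4 + 4 * W) ^ 2 := by
      have : (2 * p * w * B) ^ 2 ≤ 4 * (p ^ 2 * w ^ 2) * (G * W) := by
        calc (2 * p * w * B) ^ 2 = 4 * (p ^ 2 * w ^ 2) * B ^ 2 := by ring
          _ ≤ _ := by gcongr
      nlinarith [sq_nonneg (G * w ^ 2 * p ^ 2 / 4 - 4 * W)]
    have h7 := abs_le_of_sq_le_sq h6 (by positivity)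
    linarith [(abs_le.1 h7).1, neg_abs_le (2 * p * w * B)]
  have h8 : 0 ≤ G * w ^ 2 * p ^ 2 / 2 + p * (L * w ^ 2 + 2 * w * B) +
      ((C + (C / a) ^ 2 * M) * w ^ 2 + 4 * W) := by nlinarith
  nlinarith [mul_nonneg hS h8]

end

/-! ### Sublevel sets and the divergence identity -/

section

variable {d : ℕ}

/-- The part of the sublevel set `{φ < 0}` with times in `I`. -/
def subDomain (φ : SpaceTime d → ℝ) (I : Set ℝ) : Set (SpaceTime d) := {q | q.2 ∈ I ∧ φ q < 0}

/-- The closed sublevel set `{φ ≤ 0}` in a cylinder of radius `R`. -/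
def closedDomain (φ : SpaceTime d → ℝ) (t₀ T R : ℝ) : Set (SpaceTime d) :=
  (Metric.closedBall 0 R ×ˢ Set.Icc t₀ T) ∩ {q | φ q ≤ 0}

variable {φ : SpaceTime d → ℝ} {t₀ T R : ℝ}

lemma isClosed_slab_inter (hφ : ContinuousOn φ (Set.univ ×ˢ Set.Icc t₀ T)) {s : Set ℝ}
    (hs : IsClosed s) : IsClosed ((Set.univ ×ˢ Set.Icc t₀ T) ∩ φ ⁻¹' s) :=
  hφ.preimage_isClosed_of_isClosed (isClosed_univ.prod isClosed_Icc) hs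

lemma isCompact_closedDomain (hφ : ContinuousOn φ (Set.univ ×ˢ Set.Icc t₀ T)) (R : ℝ) :
    IsCompact (closedDomain φ t₀ T R) := by
  have h1 : closedDomain φ t₀ T R = (Metric.closedBall 0 R ×ˢ Set.Icc t₀ T) ∩
      ((Set.univ ×ˢ Set.Icc t₀ T) ∩ φ ⁻¹' Set.Iic 0) := by
    ext q
    simp only [closedDomain, Set.mem_inter_iff, Set.mem_prod, Set.mem_univ, true_and,
      Set.mem_preimage, Set.mem_Iic, Set.mem_ofPred_eq]
    tauto
  rw [h1]
  exact ((isCompact_closedBall 0 R).prod isCompact_Icc).inter_right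
    (isClosed_slab_inter hφ isClosed_Iic)

lemma closedDomain_subset_slab : closedDomain φ t₀ T R ⊆ Set.univ ×ˢ Set.Icc t₀ T :=
  fun _ hq => ⟨trivial, hq.1.2⟩

lemma measurableSet_subDomain (hφ : ContinuousOn φ (Set.univ ×ˢ Set.Icc t₀ T)) {I : Set ℝ}
    (hI : MeasurableSet I) (hIs : I ⊆ Set.Icc t₀ T) : MeasurableSet (subDomain φ I) := by
  have h1 : subDomain φ I = (Prod.snd ⁻¹' I) \ ((Set.univ ×ˢ Set.Icc t₀ T) ∩ φ ⁻¹' Set.Ici 0) := by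
    ext q
    simp only [subDomain, Set.mem_ofPred_eq, Set.mem_sdiff, Set.mem_preimage, Set.mem_inter_iff,
      Set.mem_prod, Set.mem_univ, true_and, Set.mem_Ici, not_and, not_le]
    exact ⟨fun h => ⟨h.1, fun _ => h.2⟩, fun h => ⟨h.1, h.2 (hIs h.1)⟩⟩
  rw [h1]
  exact (measurable_snd hI).diff (isClosed_slab_inter hφ isClosed_Ici).measurableSet

lemma subDomain_subset_closedDomain (hR : ∀ t ∈ Set.Icc t₀ T, ∀ x ∈ Omega φ t, ‖x‖ ≤ R)
    {I : Set ℝ} (hIs : I ⊆ Set.Icc t₀ T) : subDomain φ I ⊆ closedDomain φ t₀ T R := by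
  intro q hq
  refine ⟨⟨?_, hIs hq.1⟩, hq.2.le⟩
  simpa using hR q.2 (hIs hq.1) q.1 hq.2

lemma integrableOn_subDomain (hφ : ContinuousOn φ (Set.univ ×ˢ Set.Icc t₀ T))
    (hR : ∀ t ∈ Set.Icc t₀ T, ∀ x ∈ Omega φ t, ‖x‖ ≤ R)
    {I : Set ℝ} (hIs : I ⊆ Set.Icc t₀ T) {f : SpaceTime d → ℝ}
    (hf : ContinuousOn f (closedDomain φ t₀ T R)) : IntegrableOn f (subDomain φ I) :=
  (hf.integrableOn_compact (isCompact_closedDomain hφ R)).mono_set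
    (subDomain_subset_closedDomain hR hIs)

instance isAddHaarMeasure_volume_spaceTime : (volume : Measure (SpaceTime d)).IsAddHaarMeasure := by
  rw [Measure.volume_eq_prod]
  infer_instance

/-- This is integration by parts along `v` against the constant function `1`. -/
lemma integral_eq_zero_of_hasLineDerivAt {F F' : SpaceTime d → ℝ} {v : SpaceTime d}
    (hF : Integrable F) (hF' : Integrable F') (h : ∀ q, HasLineDerivAt ℝ F (F' q) q v) :
    ∫ q, F' q = 0 := by
  have := integral_bilinear_hasLineDerivAt_right_eq_neg_left_of_integrable
    (μ := (volume : Measure (SpaceTime d))) (f := F) (f' := F') (g := fun _ => (1 : ℝ))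
    (g' := fun _ => (0 : ℝ)) (v := v) (B := ContinuousLinearMap.mul ℝ ℝ)
    (by simpa using hF') (by simp) (by simpa using hF) (fun q _ => h q)
    (fun q _ => by simpa [HasLineDerivAt] using hasDerivAt_const _ _)
  simpa using this

/-- The integrand is the derivative in direction `e` of `cutRecip η δ (φ) ∂ₑφ w²`. Extended by zero,
this function is differentiable along space lines everywhere, so there is no boundary term. No time
derivative enters, which is why `I` may be any measurable set of times. -/
lemma integral_div_cutRecip (hlt : t₀ < T)
    (hφ : ContDiffOn ℝ ∞ φ (Set.univ ×ˢ Set.Icc t₀ T))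
    (hR : ∀ t ∈ Set.Icc t₀ T, ∀ x ∈ Omega φ t, ‖x‖ ≤ R)
    {I : Set ℝ} (hI : MeasurableSet I) (hIs : I ⊆ Set.Icc t₀ T)
    (e : EuclideanSpace ℝ (Fin d)) {w : SpaceTime d → ℝ} (hw : ContDiff ℝ ∞ w) {η δ : ℝ}
    (hη : 0 < η) (hδ : 0 < δ) :
    IntegrableOn (fun q => cutRecipDeriv η δ (φ q) * (dirD e φ q ^ 2 * w q ^ 2) +
      cutRecip η δ (φ q) * (dirD e (dirD e φ) q * w q ^ 2 +
        2 * w q * (dirD e w q * dirD e φ q))) (subDomain φ I) ∧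
    ∫ q in subDomain φ I, (cutRecipDeriv η δ (φ q) * (dirD e φ q ^ 2 * w q ^ 2) +
      cutRecip η δ (φ q) * (dirD e (dirD e φ) q * w q ^ 2 +
        2 * w q * (dirD e w q * dirD e φ q))) = 0 := by
  have hs := closedDomain_subset_slab (φ := φ) (t₀ := t₀) (T := T) (R := R)
  have c0 : ContinuousOn φ (closedDomain φ t₀ T R) := hφ.continuousOn.mono hs
  have c1 : ContinuousOn (dirD e φ) (closedDomain φ t₀ T R) :=
    (dirD_contDiffOn hlt hφ e).continuousOn.mono hs
  have c2 : ContinuousOn (dirD e (dirD e φ)) (closedDomain φ t₀ T R) :=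
    (dirD_contDiffOn hlt (dirD_contDiffOn hlt hφ e) e).continuousOn.mono hs
  have c3 : ContinuousOn w (closedDomain φ t₀ T R) := hw.continuous.continuousOn
  have c4 : ContinuousOn (dirD e w) (closedDomain φ t₀ T R) :=
    (dirD_contDiff hw e).continuous.continuousOn
  have c5 : ContinuousOn (fun q => cutRecip η δ (φ q)) (closedDomain φ t₀ T R) :=
    (continuousOn_cutRecip hη).comp c0 fun q hq => hq.2
  have c6 : ContinuousOn (fun q => cutRecipDeriv η δ (φ q)) (closedDomain φ t₀ T R) :=
    (continuousOn_cutRecipDeriv hη).comp c0 fun q hq => hq.2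
  have hm := measurableSet_subDomain hφ.continuousOn hI hIs
  have i1 : IntegrableOn (fun q => cutRecipDeriv η δ (φ q) * (dirD e φ q ^ 2 * w q ^ 2) +
      cutRecip η δ (φ q) * (dirD e (dirD e φ) q * w q ^ 2 +
        2 * w q * (dirD e w q * dirD e φ q))) (subDomain φ I) :=
    integrableOn_subDomain hφ.continuousOn hR hIs (by fun_prop)
  have i2 : IntegrableOn (fun q => cutRecip η δ (φ q) * (dirD e φ q * w q ^ 2))
      (subDomain φ I) := integrableOn_subDomain hφ.continuousOn hR hIs (by fun_prop)
  refine ⟨i1, ?_⟩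
  rw [← integral_indicator hm]
  refine integral_eq_zero_of_hasLineDerivAt (v := (e, 0)) (i2.integrable_indicator hm)
    (i1.integrable_indicator hm) fun q => ?_
  by_cases hq : q.2 ∈ I
  · have hqI := hIs hq
    -- At an admissible time the formula already vanishes for `φ ≥ 0`, so on that time slice the
    -- indicator may be dropped.
    have key : ∀ p : SpaceTime d, p.2 = q.2 →
        (subDomain φ I).indicator (fun q => cutRecip η δ (φ q) * (dirD e φ q * w q ^ 2)) p =
          cutRecip η δ (φ p) * (dirD e φ p * w p ^ 2) := by
      intro p hp
      by_cases h0 : φ p < 0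
      · rw [Set.indicator_of_mem]
        exact ⟨hp ▸ hq, h0⟩
      · rw [Set.indicator_of_notMem (fun h => h0 h.2), cutRecip_of_nonneg hδ (not_lt.1 h0),
          zero_mul]
    have key' : (subDomain φ I).indicator
        (fun q => cutRecipDeriv η δ (φ q) * (dirD e φ q ^ 2 * w q ^ 2) +
          cutRecip η δ (φ q) * (dirD e (dirD e φ) q * w q ^ 2 +
          2 * w q * (dirD e w q * dirD e φ q))) q =
        (cutRecipDeriv η δ (φ q) * (dirD e φ q ^ 2 * w q ^ 2) +
          cutRecip η δ (φ q) * (dirD e (dirD e φ) q * w q ^ 2 +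
          2 * w q * (dirD e w q * dirD e φ q))) := by
      by_cases h0 : φ q < 0
      · rw [Set.indicator_of_mem]
        exact ⟨hq, h0⟩
      · rw [Set.indicator_of_notMem (fun h => h0 h.2), cutRecip_of_nonneg hδ (not_lt.1 h0),
          cutRecipDeriv_of_nonneg hδ (not_lt.1 h0)]
        simp
    rw [key']
    have d0 := hasLineDerivAt_dirD (q := q)
      (((slice_contDiff hφ hqI).differentiable (by simp)) q.1) e
    have d1 := hasLineDerivAt_dirD (q := q)
      (((slice_contDiff (dirD_contDiffOn hlt hφ e) hqI).differentiable (by simp)) q.1) e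
    have d2 := hasLineDerivAt_dirD (q := q) (f := w)
      (((hw.comp (contDiff_id.prodMk contDiff_const)).differentiable (by simp)) q.1) e
    have d3 : HasDerivAt (fun τ : ℝ => cutRecip η δ (φ (q + τ • (e, 0))))
        (cutRecipDeriv η δ (φ q) * dirD e φ q) 0 := by
      refine HasDerivAt.comp (0 : ℝ) (h₂ := cutRecip η δ)
        (h := fun τ : ℝ => φ (q + τ • (e, 0))) ?_ d0
      simpa using hasDerivAt_cutRecip hη hδ (φ q)
    have d4 := d3.mul (HasDerivAt.mul d1 (HasDerivAt.pow d2 2))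
    unfold HasLineDerivAt at d4 ⊢
    have e1 : (fun τ : ℝ => (subDomain φ I).indicator
        (fun q => cutRecip η δ (φ q) * (dirD e φ q * w q ^ 2)) (q + τ • (e, 0))) =
        fun τ : ℝ => cutRecip η δ (φ (q + τ • (e, 0))) *
          (dirD e φ (q + τ • (e, 0)) * w (q + τ • (e, 0)) ^ 2) := by
      ext τ
      exact key _ (by simp)
    rw [e1]
    refine d4.congr_deriv ?_
    have z : q + (0 : ℝ) • ((e, 0) : SpaceTime d) = q := by rw [zero_smul, add_zero]
    simp only [Pi.mul_apply, Pi.pow_apply, z]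
    push_cast
    ring
  · have h0 : ∀ p : SpaceTime d, p.2 = q.2 → p ∉ subDomain φ I := fun p hp h => hq (hp ▸ h.1)
    rw [Set.indicator_of_notMem (h0 q rfl)]
    unfold HasLineDerivAt
    have e1 : (fun τ : ℝ => (subDomain φ I).indicator
        (fun q => cutRecip η δ (φ q) * (dirD e φ q * w q ^ 2)) (q + τ • (e, 0))) =
        fun τ : ℝ => 0 := by
      ext τ
      exact Set.indicator_of_notMem (h0 _ (by simp)) _
    rw [e1]
    exact hasDerivAt_const _ _

end

/-! ### The energy form of the Hardy inequality -/

section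

variable {d : ℕ} {φ : SpaceTime d → ℝ} {t₀ T R : ℝ} {c : SpaceTime d}

/-- Some eigenvalue is nonnegative, hence positive by nondegeneracy. Its eigenvector gives the
direction. -/
lemma exists_quadForm_pos (hφ : IsLevelSetEvolution φ t₀ T c) (hcase : ¬ IsHoleOrVoidCase φ c) :
    ∃ v : EuclideanSpace ℝ (Fin d), 0 < ∑ i, ∑ j, v i * v j * spaceHess φ c i j := by
  unfold IsHoleOrVoidCase at hcase
  push Not at hcase
  obtain ⟨l, hl, hl0⟩ := hcase
  have hl1 : l ≠ 0 := by
    rintro rfl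
    rw [spectrum.zero_mem_iff, Matrix.isUnit_iff_isUnit_det, isUnit_iff_ne_zero] at hl
    exact hl hφ.nondegenerate
  have hlp : 0 < l := lt_of_le_of_ne hl0 (Ne.symm hl1)
  rw [spectrum.mem_iff, Matrix.isUnit_iff_isUnit_det, isUnit_iff_ne_zero, not_not,
    ← Matrix.exists_mulVec_eq_zero_iff] at hl
  obtain ⟨v, hv0, hv⟩ := hl
  rw [Matrix.sub_mulVec, sub_eq_zero, Matrix.algebraMap_eq_diagonal] at hv
  refine ⟨WithLp.toLp 2 v, ?_⟩
  have h1 : ∀ i, ∑ j, spaceHess φ c i j * v j = l * v i := by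
    intro i
    have := congrFun hv i
    rw [Matrix.mulVec_diagonal] at this
    rw [← show (spaceHess φ c).mulVec v i = ∑ j, spaceHess φ c i j * v j from rfl, ← this]
    simp
  have h2 : ∑ i, ∑ j, v i * v j * spaceHess φ c i j = l * ∑ i, v i ^ 2 := by
    rw [Finset.mul_sum]
    refine Finset.sum_congr rfl fun i _ => ?_
    calc ∑ j, v i * v j * spaceHess φ c i j = v i * ∑ j, spaceHess φ c i j * v j := by
          rw [Finset.mul_sum]; exact Finset.sum_congr rfl fun j _ => by ring
      _ = _ := by rw [h1]; ring
  simp only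
  rw [h2]
  refine mul_pos hlp ?_
  obtain ⟨i, hi⟩ := Function.ne_iff.1 hv0
  exact Finset.sum_pos' (fun i _ => sq_nonneg _) ⟨i, Finset.mem_univ _, by
    have : v i ≠ 0 := hi
    positivity⟩

/-- This is the Cauchy–Schwarz inequality for the form of `A = v vᵀ + a I`: `x`, `y` are the
components along `v`, and `P` is the ordinary inner product. -/
lemma sq_add_mul_le {x y P N Nw a : ℝ} (ha : 0 ≤ a) (hN : 0 ≤ N) (hNw : 0 ≤ Nw)
    (hP : P ^ 2 ≤ Nw * N) :
    (x * y + a * P) ^ 2 ≤ (y ^ 2 + a * N) * (x ^ 2 + a * Nw) := by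
  have h1 : (2 * (x * y * P)) ^ 2 ≤ (x ^ 2 * N + y ^ 2 * Nw) ^ 2 := by
    have h2 : (2 * (x * y * P)) ^ 2 ≤ 4 * (x ^ 2 * y ^ 2) * (Nw * N) := by
      calc (2 * (x * y * P)) ^ 2 = 4 * (x ^ 2 * y ^ 2) * P ^ 2 := by ring
        _ ≤ _ := by gcongr
    nlinarith [sq_nonneg (x ^ 2 * N - y ^ 2 * Nw)]
  have h3 := (le_abs_self _).trans (abs_le_of_sq_le_sq h1 (by positivity))
  nlinarith [mul_le_mul_of_nonneg_left h3 ha, mul_le_mul_of_nonneg_left hP (sq_nonneg a)]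

/-- The part of the layer `{-δ ≤ φ < 0}` with times in `I`. -/
def tube (φ : SpaceTime d → ℝ) (I : Set ℝ) (δ : ℝ) : Set (SpaceTime d) :=
  {q | q.2 ∈ I ∧ -δ ≤ φ q ∧ φ q < 0}

lemma tube_subset_subDomain (φ : SpaceTime d → ℝ) (I : Set ℝ) (δ : ℝ) :
    tube φ I δ ⊆ subDomain φ I := fun _ hq => ⟨hq.1, hq.2.2⟩

lemma measurableSet_tube (hφ : ContinuousOn φ (Set.univ ×ˢ Set.Icc t₀ T)) {I : Set ℝ}
    (hI : MeasurableSet I) (hIs : I ⊆ Set.Icc t₀ T) (δ : ℝ) : MeasurableSet (tube φ I δ) := by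
  have h1 : tube φ I δ = subDomain φ I ∩ ((Set.univ ×ˢ Set.Icc t₀ T) ∩ φ ⁻¹' Set.Ici (-δ)) := by
    ext q
    simp only [subDomain, tube, Set.mem_ofPred_eq, Set.mem_preimage, Set.mem_inter_iff,
      Set.mem_prod, Set.mem_univ, true_and, Set.mem_Ici]
    exact ⟨fun h => ⟨⟨h.1, h.2.2⟩, hIs h.1, h.2.1⟩, fun h => ⟨h.1.1, h.2.2, h.1.2⟩⟩
  rw [h1]
  exact (measurableSet_subDomain hφ hI hIs).inter
    (isClosed_slab_inter hφ isClosed_Ici).measurableSet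

lemma continuousOn_spaceGrad (hlt : t₀ < T)
    (hφ : ContDiffOn ℝ ∞ φ (Set.univ ×ˢ Set.Icc t₀ T)) :
    ContinuousOn (spaceGrad φ) (Set.univ ×ˢ Set.Icc t₀ T) := by
  have : spaceGrad φ = fun q => WithLp.toLp 2 (fun i => dirD (stdVec i) φ q) := by
    ext q; rw [spaceGrad_eq_toLp]
  rw [this]
  refine (PiLp.continuous_toLp 2 _).comp_continuousOn (continuousOn_pi.2 fun i => ?_)
  exact (dirD_contDiffOn hlt hφ _).continuousOn

lemma continuous_spaceGrad {w : SpaceTime d → ℝ} (hw : ContDiff ℝ ∞ w) :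
    Continuous (spaceGrad w) := by
  have : spaceGrad w = fun q => WithLp.toLp 2 (fun i => dirD (stdVec i) w q) := by
    ext q; rw [spaceGrad_eq_toLp]
  rw [this]
  exact (PiLp.continuous_toLp 2 _).comp (continuous_pi fun i => (dirD_contDiff hw _).continuous)

-- The order of quantifiers is the point: `C` is chosen before `η`, whereas `C'` blows up like `1/η`
-- and only multiplies the layer term, which will vanish for zero trace.
set_option maxHeartbeats 1600000 in
lemma exists_hardy_energy (hφ : IsLevelSetEvolution φ t₀ T c) (hcase : ¬ IsHoleOrVoidCase φ c)
    (hR : ∀ t ∈ Set.Icc t₀ T, ∀ x ∈ Omega φ t, ‖x‖ ≤ R) :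
    ∃ C : ℝ, 0 ≤ C ∧ ∀ η : ℝ, 0 < η → ∃ C' : ℝ, 0 ≤ C' ∧ ∀ I : Set ℝ, MeasurableSet I →
      I ⊆ Set.Icc t₀ T → ∀ w : SpaceTime d → ℝ, ContDiff ℝ ∞ w → ∀ δ : ℝ, 0 < δ →
      ∫ q in subDomain φ I, Real.smoothTransition (-φ q / δ) *
          (‖spaceGrad φ q‖ ^ 2 * w q ^ 2 * ((η - φ q)⁻¹) ^ 2) ≤
        C * (∫ q in subDomain φ I, (w q ^ 2 + ‖spaceGrad w q‖ ^ 2)) +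
        C' / δ * ∫ q in tube φ I δ, w q ^ 2 := by
  have hlt := hφ.lt
  have hs := closedDomain_subset_slab (φ := φ) (t₀ := t₀) (T := T) (R := R)
  have hφc := hφ.smooth.continuousOn
  have hc2 : c.2 ∈ Set.Icc t₀ T := by
    rcases hφ.time with h | ⟨-, h | h⟩
    · exact ⟨h.1.le, h.2.le⟩
    · exact ⟨h.1.ge, h.1.le.trans hlt.le⟩
    · exact ⟨hlt.le.trans h.1.ge, h.1.le⟩
  obtain ⟨v, hv⟩ := exists_quadForm_pos hφ hcase
  -- The term `a I` is needed so that `A` controls the full gradient, and `a` is so small that the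
  -- trace of the Hessian cannot destroy the positivity obtained from `v`.
  obtain ⟨a, ha, hva⟩ : ∃ a : ℝ, 0 < a ∧
      0 < ∑ i, ∑ j, v i * v j * spaceHess φ c i j + a * ∑ k, spaceHess φ c k k := by
    set X := ∑ i, ∑ j, v i * v j * spaceHess φ c i j
    set Y := ∑ k, spaceHess φ c k k
    refine ⟨X / (2 * (|Y| + 1)), by positivity, ?_⟩
    have h1 : X / (2 * (|Y| + 1)) * |Y| ≤ X / 2 := by
      rw [div_mul_eq_mul_div, div_le_div_iff₀ (by positivity) (by positivity)]
      nlinarith [abs_nonneg Y]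
    have h2 : -(X / (2 * (|Y| + 1)) * |Y|) ≤ X / (2 * (|Y| + 1)) * Y := by
      rw [← mul_neg]
      gcongr
      exact neg_abs_le Y
    linarith
  -- With `A = v vᵀ + a I`, these are `G = A∇φ·∇φ` and `Lp = div(A∇φ)`.
  set G : SpaceTime d → ℝ := fun q => dirD v φ q ^ 2 + a * ∑ i, dirD (stdVec i) φ q ^ 2 with hG
  set Lp : SpaceTime d → ℝ := fun q => dirD v (dirD v φ) q +
    a * ∑ i, dirD (stdVec i) (dirD (stdVec i) φ) q with hLp
  have cD : ∀ e, ContinuousOn (dirD e φ) (closedDomain φ t₀ T R) := fun e =>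
    (dirD_contDiffOn hlt hφ.smooth e).continuousOn.mono hs
  have cDD : ∀ e, ContinuousOn (dirD e (dirD e φ)) (closedDomain φ t₀ T R) := fun e =>
    (dirD_contDiffOn hlt (dirD_contDiffOn hlt hφ.smooth e) e).continuousOn.mono hs
  have c0 : ContinuousOn φ (closedDomain φ t₀ T R) := hφc.mono hs
  have cG : ContinuousOn G (closedDomain φ t₀ T R) :=
    ((cD v).pow 2).add ((continuousOn_finsetSum _ fun i _ => (cD _).pow 2).const_mul a)
  have cL : ContinuousOn Lp (closedDomain φ t₀ T R) :=
    (cDD v).add ((continuousOn_finsetSum _ fun i _ => cDD _).const_mul a)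
  have cN : ContinuousOn (fun q => ‖spaceGrad φ q‖ ^ 2) (closedDomain φ t₀ T R) :=
    (((continuousOn_spaceGrad hlt hφ.smooth).mono hs).norm).pow 2
  have hK := isCompact_closedDomain hφc R
  -- On the zero level the gradient vanishes only at `c`, where `-Lp < 0` by the choice of `v` and
  -- `a`.
  obtain ⟨C1, hC1, hL⟩ : ∃ C : ℝ, 0 ≤ C ∧ ∀ q ∈ closedDomain φ t₀ T R,
      -Lp q ≤ C * (‖spaceGrad φ q‖ ^ 2 + |φ q|) := by
    refine exists_le_mul_of_isCompact hK cL.neg (cN.add c0.abs) (fun q _ => by positivity) ?_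
    intro q hq h0
    have h1 : φ q = 0 := by
      have : |φ q| = 0 := le_antisymm (by nlinarith [sq_nonneg ‖spaceGrad φ q‖]) (abs_nonneg _)
      exact abs_eq_zero.1 this
    have h2 : spaceGrad φ q = 0 := by
      rw [h1, abs_zero, add_zero] at h0
      simpa using h0
    have h3 : q = c := by
      by_contra hne
      exact hφ.isolated q.2 hq.1.2 q.1 h1 hne h2
    rw [h3, neg_lt_zero, hLp]
    simp only
    rw [dirD_dirD_eq_sum hlt hφ.smooth v hc2]
    simp only [dirD_stdVec_dirD_stdVec hlt hφ.smooth _ hc2]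
    exact hva
  obtain ⟨M₀, hM₀⟩ := hK.exists_bound_of_continuousOn cG
  set M := max M₀ 0 with hMdef
  have hM : ∀ q ∈ closedDomain φ t₀ T R, G q ≤ M := fun q hq =>
    (le_abs_self _).trans ((hM₀ q hq).trans (le_max_left _ _))
  have hM0 : 0 ≤ M := le_max_right _ _
  obtain ⟨L₀, hL₀, hL₀'⟩ := exists_abs_deriv_smoothTransition_le
  set V2 := ∑ i, v i ^ 2 with hV2
  have hV2' : 0 ≤ V2 := Finset.sum_nonneg fun i _ => sq_nonneg _
  set C3 := C1 + (C1 / a) ^ 2 * M + 4 * (V2 + a) with hC3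
  have hC3' : 0 ≤ C3 := by positivity
  refine ⟨2 / a * C3, by positivity, fun η hη => ⟨2 / a * (L₀ * M / η), by positivity, ?_⟩⟩
  intro I hI hIs w hw δ hδ
  have hsub := subDomain_subset_closedDomain hR hIs
  have hm := measurableSet_subDomain hφc hI hIs
  have cw : ContinuousOn w (closedDomain φ t₀ T R) := hw.continuous.continuousOn
  have cgw : ContinuousOn (fun q => ‖spaceGrad w q‖ ^ 2) (closedDomain φ t₀ T R) :=
    ((continuous_spaceGrad hw).norm.pow 2).continuousOn
  set TT : EuclideanSpace ℝ (Fin d) → SpaceTime d → ℝ := fun e q =>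
    cutRecipDeriv η δ (φ q) * (dirD e φ q ^ 2 * w q ^ 2) +
      cutRecip η δ (φ q) * (dirD e (dirD e φ) q * w q ^ 2 +
        2 * w q * (dirD e w q * dirD e φ q)) with hTT
  have hibp := fun e => integral_div_cutRecip hlt hφ.smooth hR hI hIs e hw hη hδ
  have iT : IntegrableOn (fun q => TT v q + a * ∑ i, TT (stdVec i) q) (subDomain φ I) :=
    (hibp v).1.add ((integrable_finsetSum _ fun i _ => (hibp (stdVec i)).1).const_mul a)
  have hT0 : ∫ q in subDomain φ I, (TT v q + a * ∑ i, TT (stdVec i) q) = 0 := by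
    rw [integral_add (hibp v).1
      ((integrable_finsetSum _ fun i _ => (hibp (stdVec i)).1).const_mul a),
      integral_const_mul, integral_finsetSum _ fun i _ => (hibp (stdVec i)).1]
    simp only [(hibp _).2, Finset.sum_const_zero, mul_zero, add_zero]
  have iW : IntegrableOn (fun q => w q ^ 2 + ‖spaceGrad w q‖ ^ 2) (subDomain φ I) :=
    integrableOn_subDomain hφc hR hIs ((cw.pow 2).add cgw)
  have iw : IntegrableOn (fun q => w q ^ 2) (subDomain φ I) :=
    integrableOn_subDomain hφc hR hIs (cw.pow 2)
  have hmt := measurableSet_tube hφc hI hIs δ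
  have cS : ContinuousOn (fun q => Real.smoothTransition (-φ q / δ)) (closedDomain φ t₀ T R) :=
    Real.smoothTransition.continuous.comp_continuousOn (c0.neg.div_const δ)
  have cinv : ContinuousOn (fun q => (η - φ q)⁻¹) (closedDomain φ t₀ T R) :=
    (continuousOn_const.sub c0).inv₀ fun q hq => by
      have : φ q ≤ 0 := hq.2
      have : 0 < η - φ q := by linarith
      exact this.ne'
  have iL : IntegrableOn (fun q => Real.smoothTransition (-φ q / δ) *
      (‖spaceGrad φ q‖ ^ 2 * w q ^ 2 * ((η - φ q)⁻¹) ^ 2)) (subDomain φ I) :=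
    integrableOn_subDomain hφc hR hIs (cS.mul ((cN.mul (cw.pow 2)).mul (cinv.pow 2)))
  -- The bracket with `TT` is the divergence, whose integral is zero. The factor `a / 2` comes from
  -- `a |∇φ|² ≤ G` and from the half of the main term left after absorption.
  have hpt : ∀ q ∈ subDomain φ I, a / 2 * (Real.smoothTransition (-φ q / δ) *
      (‖spaceGrad φ q‖ ^ 2 * w q ^ 2 * ((η - φ q)⁻¹) ^ 2)) ≤
      (TT v q + a * ∑ i, TT (stdVec i) q) + C3 * (w q ^ 2 + ‖spaceGrad w q‖ ^ 2) +
      L₀ * M / η / δ * (tube φ I δ).indicator (fun q => w q ^ 2) q := by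
    intro q hq
    have hqK := hsub hq
    have hφq : φ q < 0 := hq.2
    have hψ : 0 < η - φ q := by linarith
    have hN : ‖spaceGrad φ q‖ ^ 2 = ∑ i, dirD (stdVec i) φ q ^ 2 := norm_spaceGrad_sq φ q
    have hNw : ‖spaceGrad w q‖ ^ 2 = ∑ i, dirD (stdVec i) w q ^ 2 := norm_spaceGrad_sq w q
    set S := Real.smoothTransition (-φ q / δ) with hS
    set D := deriv Real.smoothTransition (-φ q / δ) with hD
    have hS0 : 0 ≤ S := Real.smoothTransition.nonneg _
    have hS1 : S ≤ 1 := Real.smoothTransition.le_one _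
    have hG0 : a * ‖spaceGrad φ q‖ ^ 2 ≤ G q := by
      simp only [hG, ← hN]
      nlinarith [sq_nonneg (dirD v φ q)]
    have hG0' : 0 ≤ G q := le_trans (by positivity) hG0
    set W := dirD v w q ^ 2 + a * ‖spaceGrad w q‖ ^ 2 with hW
    set P := ∑ i, dirD (stdVec i) w q * dirD (stdVec i) φ q with hP
    have hP2 : P ^ 2 ≤ ‖spaceGrad w q‖ ^ 2 * ‖spaceGrad φ q‖ ^ 2 := by
      rw [hN, hNw]
      exact Finset.sum_mul_sq_le_sq_mul_sq _ _ _
    have hB : (dirD v w q * dirD v φ q + a * P) ^ 2 ≤ G q * W := by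
      simp only [hG, ← hN]
      exact sq_add_mul_le ha.le (by positivity) (by positivity) hP2
    have hWle : W ≤ (V2 + a) * ‖spaceGrad w q‖ ^ 2 := by
      have : dirD v w q ^ 2 ≤ V2 * ‖spaceGrad w q‖ ^ 2 := by
        rw [hNw, dirD_eq_sum v]
        exact Finset.sum_mul_sq_le_sq_mul_sq _ _ _
      rw [hW, add_mul]
      gcongr
    have hLq : -Lp q ≤ C1 * (G q / a + (η - φ q)) := by
      refine (hL q hqK).trans ?_
      rw [abs_of_neg hφq]
      gcongr
      · rw [le_div_iff₀ ha]; linarith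
      · linarith
    have key := hardy_pointwise (S := S) (Sd := D / δ) (w := w q) hS0 hψ hG0' (hM q hqK) ha hLq
      (by positivity : 0 ≤ W) hB
    have hTeq : TT v q + a * ∑ i, TT (stdVec i) q =
        (S * (η - φ q)⁻¹ ^ 2 - D / δ * (η - φ q)⁻¹) * (G q * w q ^ 2) +
        S * (η - φ q)⁻¹ * (Lp q * w q ^ 2 + 2 * w q * (dirD v w q * dirD v φ q + a * P)) := by
      have : ∑ i, TT (stdVec i) q =
          cutRecipDeriv η δ (φ q) * ((∑ i, dirD (stdVec i) φ q ^ 2) * w q ^ 2) +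
          cutRecip η δ (φ q) * ((∑ i, dirD (stdVec i) (dirD (stdVec i) φ) q) * w q ^ 2 +
          2 * w q * P) := by
        simp only [hTT, hP, Finset.sum_add_distrib, ← Finset.mul_sum, ← Finset.sum_mul]
      rw [this]
      simp only [hTT, hG, hLp, cutRecip, cutRecipDeriv, hS, hD]
      ring
    rw [← hTeq] at key
    have k1 : S * ((C1 + (C1 / a) ^ 2 * M) * w q ^ 2 + 4 * W) ≤
        C3 * (w q ^ 2 + ‖spaceGrad w q‖ ^ 2) := by
      calc S * ((C1 + (C1 / a) ^ 2 * M) * w q ^ 2 + 4 * W)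
          ≤ 1 * ((C1 + (C1 / a) ^ 2 * M) * w q ^ 2 + 4 * W) := by gcongr
        _ ≤ (C1 + (C1 / a) ^ 2 * M) * w q ^ 2 + 4 * ((V2 + a) * ‖spaceGrad w q‖ ^ 2) := by
          rw [one_mul]; gcongr
        _ ≤ _ := by
          have : 0 ≤ (C1 + (C1 / a) ^ 2 * M) * ‖spaceGrad w q‖ ^ 2 := by positivity
          have : 0 ≤ 4 * (V2 + a) * w q ^ 2 := by positivity
          rw [hC3]; nlinarith
    -- The derivative of the step lives where `-φ / δ ≤ 1`, that is, in the layer. There the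
    -- reciprocal is at most `1/η`.
    have k2 : D / δ * (η - φ q)⁻¹ * (G q * w q ^ 2) ≤
        L₀ * M / η / δ * (tube φ I δ).indicator (fun q => w q ^ 2) q := by
      by_cases ht : -δ ≤ φ q
      · rw [Set.indicator_of_mem (show q ∈ tube φ I δ from ⟨hq.1, ht, hφq⟩)]
        have h1 : D ≤ L₀ := (le_abs_self _).trans (hL₀' _)
        have h2 : (η - φ q)⁻¹ ≤ η⁻¹ := by
          gcongr; linarith
        calc D / δ * (η - φ q)⁻¹ * (G q * w q ^ 2) ≤ L₀ / δ * η⁻¹ * (M * w q ^ 2) := by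
              have := hM q hqK
              gcongr
          _ = _ := by field_simp
      · have h1 : 1 ≤ -φ q / δ := by rw [le_div_iff₀ hδ]; linarith
        rw [hD, deriv_smoothTransition_of_one_le h1,
          Set.indicator_of_notMem (fun h => ht h.2.1)]
        simp
    have k3 : a / 2 * (S * (‖spaceGrad φ q‖ ^ 2 * w q ^ 2 * ((η - φ q)⁻¹) ^ 2)) ≤
        S * (G q * w q ^ 2 * ((η - φ q)⁻¹) ^ 2) / 2 := by
      have : S * (w q ^ 2 * ((η - φ q)⁻¹) ^ 2) * (a * ‖spaceGrad φ q‖ ^ 2) ≤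
        S * (w q ^ 2 * ((η - φ q)⁻¹) ^ 2) * G q := by gcongr
      linarith
    linarith
  have iind : IntegrableOn ((tube φ I δ).indicator (fun q => w q ^ 2)) (subDomain φ I) :=
    iw.integrable.indicator hmt
  have i12 : IntegrableOn (fun q => (TT v q + a * ∑ i, TT (stdVec i) q) +
      C3 * (w q ^ 2 + ‖spaceGrad w q‖ ^ 2)) (subDomain φ I) := iT.add (iW.const_mul C3)
  have hint := setIntegral_mono_on (iL.const_mul (a / 2)) (i12.add (iind.const_mul (L₀ * M / η / δ))) hm hpt
  rw [integral_const_mul] at hint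
  simp only [Pi.add_apply] at hint
  rw [integral_add i12 (iind.const_mul _), integral_add iT (iW.const_mul C3), hT0, integral_const_mul, integral_const_mul,
    setIntegral_indicator hmt, Set.inter_eq_right.2 (tube_subset_subDomain φ I δ)] at hint
  have := mul_le_mul_of_nonneg_left hint (show 0 ≤ 2 / a by positivity)
  calc _ = 2 / a * (a / 2 * ∫ q in subDomain φ I, Real.smoothTransition (-φ q / δ) *
          (‖spaceGrad φ q‖ ^ 2 * w q ^ 2 * ((η - φ q)⁻¹) ^ 2)) := by field_simp
    _ ≤ _ := this
    _ = _ := by ring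

end

/-! ### Projection along a coordinate and surface measure -/

section

variable {d : ℕ}

/-- The map `(x, t) ↦ x` with the `i`-th coordinate of `x` replaced by `t`. -/
noncomputable def dropCoord (i : Fin d) : SpaceTime d →ₗ[ℝ] EuclideanSpace ℝ (Fin d) where
  toFun q := q.1 + (q.2 - q.1 i) • stdVec i
  map_add' p q := by
    simp only [Prod.fst_add, Prod.snd_add, PiLp.add_apply]
    module
  map_smul' r q := by
    simp only [Prod.smul_fst, Prod.smul_snd, PiLp.smul_apply, smul_eq_mul, RingHom.id_apply]
    module

lemma dropCoord_apply (i : Fin d) (q : SpaceTime d) :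
    dropCoord i q = q.1 + (q.2 - q.1 i) • stdVec i := rfl

lemma dropCoord_apply_same (i : Fin d) (q : SpaceTime d) : dropCoord i q i = q.2 := by
  simp [dropCoord_apply, stdVec]

/-- The map that exchanges the `i`-th space coordinate and the time. -/
noncomputable def swapCoord (i : Fin d) : SpaceTime d →ₗ[ℝ] SpaceTime d where
  toFun q := (dropCoord i q, q.1 i)
  map_add' p q := by ext <;> simp
  map_smul' r q := by ext <;> simp

lemma swapCoord_apply (i : Fin d) (q : SpaceTime d) :
    swapCoord i q = (dropCoord i q, q.1 i) := rfl

lemma swapCoord_swapCoord (i : Fin d) (q : SpaceTime d) : swapCoord i (swapCoord i q) = q := by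
  have h : dropCoord i (swapCoord i q) = q.1 := by
    rw [dropCoord_apply, swapCoord_apply]
    simp only [dropCoord_apply_same]
    rw [dropCoord_apply]
    module
  rw [swapCoord_apply i (swapCoord i q), h, swapCoord_apply]
  simp only [dropCoord_apply_same]

/-- A linear involution has determinant `±1`. The map lets Fubini's theorem single out the `i`-th
space coordinate, the time taking its place in `ℝ^d`. -/
lemma measurePreserving_swapCoord (i : Fin d) :
    MeasurePreserving (swapCoord i) (volume : Measure (SpaceTime d)) volume := by
  have h1 : swapCoord i ∘ₗ swapCoord i = LinearMap.id := by
    ext1 <;> ext1 <;> simp [swapCoord_swapCoord]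
  have h2 : LinearMap.det (swapCoord i : SpaceTime d →ₗ[ℝ] SpaceTime d) *
      LinearMap.det (swapCoord i : SpaceTime d →ₗ[ℝ] SpaceTime d) = 1 := by
    rw [← LinearMap.det_comp, h1, LinearMap.det_id]
  have h3 : |LinearMap.det (swapCoord i : SpaceTime d →ₗ[ℝ] SpaceTime d)| = 1 := by
    rcases mul_self_eq_one_iff.1 h2 with h | h <;> simp [h]
  have h4 : LinearMap.det (swapCoord i : SpaceTime d →ₗ[ℝ] SpaceTime d) ≠ 0 := by
    intro h; simp [h] at h3
  refine ⟨(LinearMap.continuous_of_finiteDimensional (swapCoord i)).measurable, ?_⟩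
  rw [Measure.map_linearMap_addHaar_eq_smul_addHaar _ h4, abs_inv, h3]
  simp

/-- The left side equals `‖x‖² + t² - xᵢ²`. -/
lemma norm_dropCoord_sq_le (i : Fin d) (q : SpaceTime d) :
    ‖dropCoord i q‖ ^ 2 ≤ ‖q.1‖ ^ 2 + q.2 ^ 2 := by
  rw [dropCoord_apply, norm_add_sq_real, norm_smul, inner_smul_right,
    EuclideanSpace.inner_single_right]
  simp only [stdVec, PiLp.norm_single, Real.norm_eq_abs, mul_pow, sq_abs]
  simp
  nlinarith [sq_nonneg (q.1 i)]

/-- In the Euclidean metric of space-time the projection is 1-Lipschitz, and such maps do not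
increase Hausdorff measure. This inequality replaces a graph parametrization of the boundary. -/
lemma volume_image_dropCoord_le (i : Fin d) {A : Set (SpaceTime d)} (hA : MeasurableSet A) :
    volume (dropCoord i '' A) ≤ surfaceMeasure d A := by
  have hL : LipschitzWith 1 (fun z : WithLp 2 (EuclideanSpace ℝ (Fin d) × ℝ) =>
      dropCoord i z.ofLp) := by
    refine LipschitzWith.of_dist_le_mul fun z z' => ?_
    rw [NNReal.coe_one, one_mul, dist_eq_norm, dist_eq_norm, ← map_sub, ← WithLp.ofLp_sub]
    refine le_of_sq_le_sq ?_ (norm_nonneg _)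
    rw [WithLp.prod_norm_sq_eq_of_L2]
    refine (norm_dropCoord_sq_le i _).trans (le_of_eq ?_)
    simp [Real.norm_eq_abs, sq_abs]
  have hm : Measurable (WithLp.ofLp : WithLp 2 (EuclideanSpace ℝ (Fin d) × ℝ) → SpaceTime d) :=
    (WithLp.prod_continuous_ofLp 2 _ _).measurable
  rw [surfaceMeasure, Measure.map_apply hm hA]
  have h1 : dropCoord i '' A = (fun z : WithLp 2 (EuclideanSpace ℝ (Fin d) × ℝ) =>
      dropCoord i z.ofLp) '' (WithLp.ofLp ⁻¹' A) := by
    rw [show (fun z : WithLp 2 (EuclideanSpace ℝ (Fin d) × ℝ) => dropCoord i z.ofLp) =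
      dropCoord i ∘ WithLp.ofLp from rfl, Set.image_comp, Set.image_preimage_eq]
    exact WithLp.ofLp_surjective 2
  rw [h1, ← EuclideanSpace.euclideanHausdorffMeasure_eq_volume]
  simp only [Measure.euclideanHausdorffMeasure_def, Measure.smul_apply]
  gcongr
  have := hL.hausdorffMeasure_image_le (d := (d : ℝ)) (by positivity) (WithLp.ofLp ⁻¹' A)
  simpa using this

lemma restrict_image_dropCoord_le (i : Fin d) {S : Set (SpaceTime d)} (hS : MeasurableSet S) :
    volume.restrict (dropCoord i '' S) ≤ ((surfaceMeasure d).restrict S).map (dropCoord i) := by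
  have hc : Measurable (dropCoord i : SpaceTime d → _) :=
    (LinearMap.continuous_of_finiteDimensional (dropCoord i)).measurable
  refine Measure.le_iff.2 fun E hE => ?_
  rw [Measure.restrict_apply hE, Measure.map_apply hc hE, Measure.restrict_apply (hc hE)]
  refine le_trans (le_of_eq ?_) (volume_image_dropCoord_le i ((hc hE).inter hS))
  congr 1
  ext y
  simp only [Set.mem_inter_iff, Set.mem_image, Set.mem_preimage]
  constructor
  · rintro ⟨hy, q, hq, rfl⟩
    exact ⟨q, ⟨hy, hq⟩, rfl⟩
  · rintro ⟨q, ⟨h1, h2⟩, rfl⟩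
    exact ⟨h1, q, h2, rfl⟩

end

/-! ### The layer in a box where one space derivative does not vanish -/

section

variable {d : ℕ} {φ : SpaceTime d → ℝ} {t₀ T : ℝ}

lemma hasDerivAt_line (hφ : ContDiffOn ℝ ∞ φ (Set.univ ×ˢ Set.Icc t₀ T)) {t : ℝ}
    (ht : t ∈ Set.Icc t₀ T) (x e : EuclideanSpace ℝ (Fin d)) (σ : ℝ) :
    HasDerivAt (fun σ : ℝ => φ (x + σ • e, t)) (dirD e φ (x + σ • e, t)) σ := by
  have h1 : HasDerivAt (fun σ : ℝ => x + σ • e) e σ := by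
    simpa using ((hasDerivAt_id σ).smul_const e).const_add x
  have h2 := (((slice_contDiff hφ ht).differentiable (by simp)) (x + σ • e)).hasFDerivAt
  exact h2.comp_hasDerivAt σ h1

/-- If `s ∂ₑφ ≥ m` along a segment in direction `e`, then `s φ` grows at least with slope `m`. -/
lemma mul_sub_le_of_le_dirD (hφ : ContDiffOn ℝ ∞ φ (Set.univ ×ˢ Set.Icc t₀ T)) {t : ℝ}
    (ht : t ∈ Set.Icc t₀ T) (x e : EuclideanSpace ℝ (Fin d)) {s m : ℝ}
    {U : Set (EuclideanSpace ℝ (Fin d))} (hU : Convex ℝ U)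
    (hm : ∀ y ∈ U, m ≤ s * dirD e φ (y, t)) {a b : ℝ} (hab : a ≤ b) (ha : x + a • e ∈ U)
    (hb : x + b • e ∈ U) :
    m * (b - a) ≤ s * (φ (x + b • e, t) - φ (x + a • e, t)) := by
  have hseg : ∀ σ ∈ Set.Icc a b, x + σ • e ∈ U := by
    intro σ hσ
    have hc : Convex ℝ {σ : ℝ | x + σ • e ∈ U} := by
      intro σ₁ h₁ σ₂ h₂ r₁ r₂ hr₁ hr₂ hr
      have := hU h₁ h₂ hr₁ hr₂ hr
      simp only [Set.mem_ofPred_eq] at *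
      convert this using 1
      have : x = (r₁ + r₂) • x := by rw [hr, one_smul]
      conv_lhs => rw [this]
      simp only [smul_eq_mul]
      module
    exact hc.ordConnected.out ha hb hσ
  have hd : ∀ σ, HasDerivAt (fun σ : ℝ => s * φ (x + σ • e, t))
      (s * dirD e φ (x + σ • e, t)) σ := fun σ => (hasDerivAt_line hφ ht x e σ).const_mul s
  have := (convex_Icc a b).mul_sub_le_image_sub_of_le_deriv (C := m)
    (f := fun σ : ℝ => s * φ (x + σ • e, t))
    (fun σ _ => (hd σ).continuousAt.continuousWithinAt)
    (fun σ _ => (hd σ).differentiableAt.differentiableWithinAt)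
    (fun σ hσ => by
      rw [(hd σ).deriv]
      exact hm _ (hseg σ (interior_subset hσ)))
    a ⟨le_rfl, hab⟩ b ⟨hab, le_rfl⟩ hab
  linarith

lemma mul_abs_sub_le_of_le_dirD (hφ : ContDiffOn ℝ ∞ φ (Set.univ ×ˢ Set.Icc t₀ T)) {t : ℝ}
    (ht : t ∈ Set.Icc t₀ T) (x e : EuclideanSpace ℝ (Fin d)) {s m : ℝ} (hs : |s| = 1)
    {U : Set (EuclideanSpace ℝ (Fin d))} (hU : Convex ℝ U)
    (hm : ∀ y ∈ U, m ≤ s * dirD e φ (y, t)) {a b : ℝ} (ha : x + a • e ∈ U)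
    (hb : x + b • e ∈ U) :
    m * |b - a| ≤ |φ (x + b • e, t) - φ (x + a • e, t)| := by
  rcases le_total a b with h | h
  · rw [abs_of_nonneg (sub_nonneg.2 h)]
    refine (mul_sub_le_of_le_dirD hφ ht x e hU hm h ha hb).trans ((le_abs_self _).trans ?_)
    rw [abs_mul, hs, one_mul]
  · rw [abs_sub_comm, abs_of_nonneg (sub_nonneg.2 h), abs_sub_comm (φ _)]
    refine (mul_sub_le_of_le_dirD hφ ht x e hU hm h hb ha).trans ((le_abs_self _).trans ?_)
    rw [abs_mul, hs, one_mul]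

/-- Every point of the layer has a point of the zero level on its line in direction `e`. -/
lemma exists_zero_on_line (hφ : ContDiffOn ℝ ∞ φ (Set.univ ×ˢ Set.Icc t₀ T)) {t : ℝ}
    (ht : t ∈ Set.Icc t₀ T) {x x₀ e : EuclideanSpace ℝ (Fin d)} (he : ‖e‖ = 1) {s m r δ : ℝ}
    (hs : s = 1 ∨ s = -1) (hm0 : 0 < m) (hr : 0 < r) (hδ : 0 < δ) (hδr : δ ≤ m * r)
    (hm : ∀ y ∈ Metric.closedBall x₀ (2 * r), m ≤ s * dirD e φ (y, t))
    (hx : x ∈ Metric.closedBall x₀ r) (h1 : -δ ≤ φ (x, t)) (h2 : φ (x, t) < 0) :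
    ∃ τ : ℝ, x + τ • e ∈ Metric.closedBall x₀ (2 * r) ∧ φ (x + τ • e, t) = 0 := by
  have hball : ∀ τ : ℝ, |τ| ≤ r → x + τ • e ∈ Metric.closedBall x₀ (2 * r) := by
    intro τ hτ
    rw [mem_closedBall_iff_norm] at hx ⊢
    calc ‖x + τ • e - x₀‖ = ‖(x - x₀) + τ • e‖ := by congr 1; abel
      _ ≤ ‖x - x₀‖ + ‖τ • e‖ := norm_add_le _ _
      _ ≤ r + r := by rw [norm_smul, he, mul_one]; exact add_le_add hx hτ
      _ = _ := by ring
  have hl : δ / m ≤ r := by rw [div_le_iff₀ hm0]; linarith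
  have hl0 : 0 ≤ δ / m := by positivity
  have hsabs : |s| = 1 := by rcases hs with rfl | rfl <;> simp
  have hs2 : s * s = 1 := by rcases hs with rfl | rfl <;> norm_num
  have habs : |s * (δ / m)| ≤ r := by rw [abs_mul, hsabs, one_mul, abs_of_nonneg hl0]; exact hl
  have hx0 : x + (0 : ℝ) • e = x := by simp
  -- Moving by `δ / m` in the direction of increase raises `φ` by at least `δ`, from at least `-δ`
  -- to a nonnegative value. The intermediate value theorem then supplies the zero.
  have hpos : 0 ≤ φ (x + (s * (δ / m)) • e, t) := by
    have hU := convex_closedBall x₀ (2 * r)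
    have hmd : m * (δ / m) = δ := by field_simp
    rcases hs with rfl | rfl
    · have := mul_sub_le_of_le_dirD hφ ht x e hU hm (a := 0) (b := 1 * (δ / m))
        (by simpa using hl0) (hball 0 (by simpa using hr.le)) (hball _ habs)
      rw [hx0] at this
      linarith
    · have := mul_sub_le_of_le_dirD hφ ht x e hU hm (a := -1 * (δ / m)) (b := 0)
        (by linarith) (hball _ habs) (hball 0 (by simpa using hr.le))
      rw [hx0] at this
      linarith
  have hcont : ContinuousOn (fun σ : ℝ => φ (x + σ • e, t)) (Set.uIcc 0 (s * (δ / m))) :=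
    fun σ _ => (hasDerivAt_line hφ ht x e σ).continuousAt.continuousWithinAt
  have hmem : (0 : ℝ) ∈ Set.uIcc (φ (x + (0 : ℝ) • e, t)) (φ (x + (s * (δ / m)) • e, t)) := by
    rw [hx0]
    exact Set.mem_uIcc.2 (Or.inl ⟨h2.le, hpos⟩)
  obtain ⟨τ, hτ, hτ0⟩ := intermediate_value_uIcc hcont hmem
  refine ⟨τ, hball τ ?_, hτ0⟩
  have := Set.abs_sub_left_of_mem_uIcc hτ
  simp only [sub_zero] at this
  exact this.trans habs

lemma eq_add_smul_of_dropCoord_eq {i : Fin d} {p q : SpaceTime d}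
    (h : dropCoord i p = dropCoord i q) : p.2 = q.2 ∧ p.1 = q.1 + (p.1 i - q.1 i) • stdVec i := by
  have h2 : p.2 = q.2 := by
    rw [← dropCoord_apply_same i p, ← dropCoord_apply_same i q, h]
  refine ⟨h2, ?_⟩
  rw [dropCoord_apply, dropCoord_apply, h2] at h
  have : p.1 = (q.1 + (q.2 - q.1 i) • stdVec i) - (q.2 - p.1 i) • stdVec i := by
    rw [← h]; abel
  rw [this]
  have e : (q.1 + (q.2 - q.1 i) • stdVec i - (q.2 - p.1 i) • stdVec i) i = p.1 i := by
    rw [← this]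
  rw [e]
  module

set_option maxHeartbeats 800000 in
/-- In a box where `∂ᵢφ` does not vanish, the integral over the layer `{-δ ≤ φ < 0}` is bounded by
`δ` times the surface integral over the zero level. -/
lemma lintegral_tube_box_le (hφ : ContDiffOn ℝ ∞ φ (Set.univ ×ˢ Set.Icc t₀ T))
    {I : Set ℝ} (hI : MeasurableSet I) (hIs : I ⊆ Set.Icc t₀ T) {i : Fin d}
    {x₀ : EuclideanSpace ℝ (Fin d)} {J : Set ℝ} (hJ : IsCompact J) {s m r : ℝ}
    (hs : s = 1 ∨ s = -1) (hm0 : 0 < m) (hr : 0 < r)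
    (hm : ∀ q ∈ Metric.closedBall x₀ (2 * r) ×ˢ J, q.2 ∈ I → m ≤ s * dirD (stdVec i) φ q)
    {w : SpaceTime d → ℝ} (hw : Continuous w) {ε : ℝ} (hε : 0 < ε) :
    ∀ᶠ δ in 𝓝[>] (0 : ℝ),
      ∫⁻ q in (Metric.closedBall x₀ r ×ˢ J) ∩ tube φ I δ, ENNReal.ofReal (w q ^ 2) ≤
        ENNReal.ofReal δ * (ENNReal.ofReal (1 / m) *
          (∫⁻ q in {q | q ∈ Metric.closedBall x₀ (2 * r) ×ˢ J ∧ q.2 ∈ I ∧ φ q = 0},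
            ENNReal.ofReal (w q ^ 2) ∂(surfaceMeasure d)) + ENNReal.ofReal ε) := by
  set K := Metric.closedBall x₀ (2 * r) ×ˢ J with hKdef
  have hK : IsCompact K := (isCompact_closedBall _ _).prod hJ
  set S : Set (SpaceTime d) := {q | q ∈ K ∧ q.2 ∈ I ∧ φ q = 0} with hSdef
  set P := dropCoord i
  have hPc : Continuous P := LinearMap.continuous_of_finiteDimensional _
  have hSm : MeasurableSet S := by
    have : S = (K ∩ Prod.snd ⁻¹' I) ∩ ((Set.univ ×ˢ Set.Icc t₀ T) ∩ φ ⁻¹' {0}) := by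
      ext q
      simp only [hSdef, Set.mem_ofPred_eq, Set.mem_inter_iff, Set.mem_preimage, Set.mem_prod,
        Set.mem_univ, true_and, Set.mem_singleton_iff]
      exact ⟨fun h => ⟨⟨h.1, h.2.1⟩, hIs h.2.1, h.2.2⟩, fun h => ⟨h.1.1, h.1.2, h.2.2⟩⟩
    rw [this]
    exact (hK.measurableSet.inter (measurable_snd hI)).inter
      (isClosed_slab_inter hφ.continuousOn isClosed_singleton).measurableSet
  have hVfin : volume (P '' K) < ⊤ := (hK.image hPc).measure_lt_top
  set V := (volume (P '' K)).toReal with hV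
  have hV0 : 0 ≤ V := ENNReal.toReal_nonneg
  -- Chosen so that `(1/m) ε' V ≤ ε`. The `+ 1` covers `V = 0`.
  set ε' := ε * m / (V + 1) with hε'
  have hε'0 : 0 < ε' := by positivity
  have huc := hK.uniformContinuousOn_of_continuous (hw.pow 2).continuousOn
  obtain ⟨ρ, hρ, hρw⟩ := Metric.uniformContinuousOn_iff.1 huc ε' hε'0
  -- The bound `δ < m r` keeps the zero on the fibre inside the doubled box. The bound `δ < m ρ`
  -- puts it within `ρ` of the layer point, so that `w²` changes by less than `ε'`.
  have hev : ∀ᶠ δ in 𝓝[>] (0 : ℝ), 0 < δ ∧ δ < m * r ∧ δ < m * ρ := by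
    filter_upwards [self_mem_nhdsWithin, nhdsWithin_le_nhds (gt_mem_nhds (mul_pos hm0 hr)),
      nhdsWithin_le_nhds (gt_mem_nhds (mul_pos hm0 hρ))] with δ h1 h2 h3
    exact ⟨h1, h2, h3⟩
  filter_upwards [hev] with δ ⟨hδ, hδr, hδρ⟩
  set A := (Metric.closedBall x₀ r ×ˢ J) ∩ tube φ I δ with hA
  have hAm : MeasurableSet A := by
    exact (((isCompact_closedBall x₀ r).prod hJ).measurableSet).inter
      (measurableSet_tube hφ.continuousOn hI hIs δ)
  have hAK : A ⊆ K := fun q hq =>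
    ⟨Metric.closedBall_subset_closedBall (by linarith) hq.1.1, hq.1.2⟩
  have hsabs : |s| = 1 := by rcases hs with rfl | rfl <;> simp
  -- Points with equal projection differ only in the `i`-th coordinate, along which `φ` has slope at
  -- least `m` in absolute value.
  have hslope : ∀ p ∈ K, ∀ q ∈ K, p.2 ∈ I → P p = P q →
      m * |p.1 i - q.1 i| ≤ |φ p - φ q| ∧ dist p q = |p.1 i - q.1 i| := by
    intro p hp q hq hpI hpq
    obtain ⟨e1, e2⟩ := eq_add_smul_of_dropCoord_eq hpq
    have hx0 : q.1 + (0 : ℝ) • stdVec i = q.1 := by simp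
    have := mul_abs_sub_le_of_le_dirD hφ (hIs hpI) q.1 (stdVec i) hsabs
      (convex_closedBall x₀ (2 * r)) (fun y hy => hm (y, p.2) ⟨hy, hp.2⟩ hpI)
      (a := 0) (b := p.1 i - q.1 i) (by rw [hx0]; exact hq.1) (by rw [← e2]; exact hp.1)
    rw [← e2, hx0, sub_zero] at this
    refine ⟨?_, ?_⟩
    · convert this using 3
      rw [e1]
    · rw [Prod.dist_eq, e1, dist_self, dist_eq_norm]
      have : p.1 - q.1 = (p.1 i - q.1 i) • stdVec i := by
        conv_lhs => rw [e2]
        abel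
      rw [this, norm_smul]
      simp [stdVec]
  -- The infimum over the fibre transfers `w²` from the zero level to the projection without
  -- selecting a zero measurably. The integral inequalities applied to `g` need no measurability of
  -- it.
  set g : EuclideanSpace ℝ (Fin d) → ℝ≥0∞ := fun y =>
    ⨅ q ∈ {q | q ∈ S ∧ P q = y}, ENNReal.ofReal (w q ^ 2) with hg
  set f : SpaceTime d → ℝ≥0∞ := fun q => ENNReal.ofReal (w q ^ 2) with hf
  have hfm : Measurable f := ((hw.measurable.pow_const 2)).ennreal_ofReal
  have hzero : ∀ q ∈ A, ∃ q' ∈ S, P q' = P q := by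
    rintro q ⟨⟨hq1, hq2⟩, hqI, hq3, hq4⟩
    obtain ⟨τ, h1, h2⟩ := exists_zero_on_line hφ (hIs hqI) (e := stdVec i) (by simp [stdVec])
      hs hm0 hr hδ hδr.le
      (fun y hy => hm (y, q.2) ⟨hy, hq2⟩ hqI) hq1 hq3 hq4
    refine ⟨(q.1 + τ • stdVec i, q.2), ⟨⟨h1, hq2⟩, hqI, h2⟩, ?_⟩
    simp only [P, dropCoord_apply]
    have : (q.1 + τ • stdVec i : EuclideanSpace ℝ (Fin d)) i = q.1 i + τ := by simp [stdVec]
    rw [this]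
    module
  have hclose : ∀ q ∈ A, f q ≤ g (P q) + ENNReal.ofReal ε' := by
    intro q hq
    rw [hg, ENNReal.iInf_add]
    refine le_iInf fun q' => ?_
    rw [ENNReal.iInf_add]
    refine le_iInf fun ⟨hq'S, hq'P⟩ => ?_
    obtain ⟨h1, h2⟩ := hslope q (hAK hq) q' hq'S.1 hq.2.1 hq'P.symm
    rw [hq'S.2.2, sub_zero, abs_of_neg hq.2.2.2] at h1
    have h3 : dist q q' < ρ := by
      rw [h2]
      have : m * |q.1 i - q'.1 i| < m * ρ := by linarith [hq.2.2.1]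
      exact lt_of_mul_lt_mul_left this hm0.le
    have h4 := hρw q (hAK hq) q' hq'S.1 h3
    rw [Real.dist_eq] at h4
    rw [← ENNReal.ofReal_add (sq_nonneg _) hε'0.le]
    refine ENNReal.ofReal_le_ofReal ?_
    have := (abs_lt.1 h4).2
    simp only [Pi.pow_apply] at this
    linarith
  -- On one fibre the layer has length at most `δ / m`, since `φ` stays in `[-δ, 0)` there. The
  -- integrand is within `ε'` of its value at a zero, and a fibre without zeros misses the layer.
  have hfib : ∀ y, ∫⁻ σ, A.indicator f (swapCoord i (y, σ)) ≤
      ENNReal.ofReal (δ / m) * (P '' S).indicator (fun y => g y + ENNReal.ofReal ε') y := by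
    intro y
    have hPs : ∀ σ, P (swapCoord i (y, σ)) = y := by
      intro σ
      have := congrArg Prod.fst (swapCoord_swapCoord i (y, σ))
      rwa [swapCoord_apply] at this
    have hPs1 : ∀ σ, (swapCoord i (y, σ)).1 i = σ := by
      intro σ
      rw [swapCoord_apply]
      exact dropCoord_apply_same i (y, σ)
    set Ty : Set ℝ := {σ | swapCoord i (y, σ) ∈ A} with hTy
    have hTym : MeasurableSet Ty := by
      have : Measurable fun σ : ℝ => swapCoord i (y, σ) :=
        (LinearMap.continuous_of_finiteDimensional (swapCoord i)).measurable.comp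
          (measurable_const.prodMk measurable_id)
      exact this hAm
    by_cases hy : y ∈ P '' S
    · rw [Set.indicator_of_mem hy]
      have h1 : ∀ σ, A.indicator f (swapCoord i (y, σ)) ≤
          Ty.indicator (fun _ => g y + ENNReal.ofReal ε') σ := by
        intro σ
        by_cases hσ : swapCoord i (y, σ) ∈ A
        · rw [Set.indicator_of_mem hσ, Set.indicator_of_mem (show σ ∈ Ty from hσ)]
          have := hclose _ hσ
          rwa [hPs] at this
        · rw [Set.indicator_of_notMem hσ]
          exact zero_le
      refine (lintegral_mono h1).trans ?_
      rw [lintegral_indicator_const hTym, mul_comm]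
      gcongr
      refine (Real.volume_le_diam Ty).trans ?_
      refine Metric.ediam_le fun σ₁ h₁ σ₂ h₂ => ?_
      rw [edist_dist]
      refine ENNReal.ofReal_le_ofReal ?_
      obtain ⟨h3, -⟩ := hslope _ (hAK h₁) _ (hAK h₂) h₁.2.1 (by rw [hPs, hPs])
      rw [hPs1, hPs1] at h3
      rw [Real.dist_eq, le_div_iff₀ hm0, mul_comm]
      refine h3.trans ?_
      rw [abs_le]
      constructor
      · linarith [h₁.2.2.1, h₂.2.2.2]
      · linarith [h₂.2.2.1, h₁.2.2.2]
    · have h1 : ∀ σ, A.indicator f (swapCoord i (y, σ)) = 0 := by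
        intro σ
        refine Set.indicator_of_notMem (fun hσ => hy ?_) _
        obtain ⟨q', h2, h3⟩ := hzero _ hσ
        exact ⟨q', h2, by rw [h3, hPs]⟩
      simp [h1]
  have hgS : ∫⁻ y in P '' S, g y ≤ ∫⁻ q in S, f q ∂(surfaceMeasure d) := by
    calc ∫⁻ y in P '' S, g y ≤ ∫⁻ y, g y ∂((surfaceMeasure d).restrict S).map P :=
          lintegral_mono' (restrict_image_dropCoord_le i hSm) le_rfl
      _ ≤ ∫⁻ q in S, g (P q) ∂(surfaceMeasure d) := lintegral_map_le _ _
      _ ≤ _ := setLIntegral_mono' hSm fun q hq => iInf₂_le q ⟨hq, rfl⟩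
  have hε'' : ENNReal.ofReal (1 / m) * (ENNReal.ofReal ε' * volume (P '' S)) ≤
      ENNReal.ofReal ε := by
    calc ENNReal.ofReal (1 / m) * (ENNReal.ofReal ε' * volume (P '' S))
        ≤ ENNReal.ofReal (1 / m) * (ENNReal.ofReal ε' * volume (P '' K)) := by
          gcongr; exact fun q hq => hq.1
      _ = ENNReal.ofReal (1 / m * (ε' * V)) := by
          rw [ENNReal.ofReal_mul (by positivity), ENNReal.ofReal_mul hε'0.le, hV,
            ENNReal.ofReal_toReal hVfin.ne]
      _ ≤ _ := by
          refine ENNReal.ofReal_le_ofReal ?_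
          rw [hε']
          have : 1 / m * (ε * m / (V + 1) * V) = ε * (V / (V + 1)) := by field_simp
          rw [this]
          have : V / (V + 1) ≤ 1 := by rw [div_le_one (by positivity)]; linarith
          nlinarith
  have hswapm : Measurable (swapCoord i : SpaceTime d → SpaceTime d) :=
    (LinearMap.continuous_of_finiteDimensional (swapCoord i)).measurable
  have hindm : Measurable (A.indicator f) := hfm.indicator hAm
  calc ∫⁻ q in A, f q = ∫⁻ q, A.indicator f q := (lintegral_indicator hAm _).symm
    _ = ∫⁻ q, A.indicator f (swapCoord i q) :=
        ((measurePreserving_swapCoord i).lintegral_comp hindm).symm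
    _ = ∫⁻ y, ∫⁻ σ, A.indicator f (swapCoord i (y, σ)) := by
        rw [Measure.volume_eq_prod, lintegral_prod]
        exact (hindm.comp hswapm).aemeasurable
    _ ≤ ∫⁻ y, ENNReal.ofReal (δ / m) *
          (P '' S).indicator (fun y => g y + ENNReal.ofReal ε') y := lintegral_mono hfib
    _ = ENNReal.ofReal (δ / m) *
          ∫⁻ y, (P '' S).indicator (fun y => g y + ENNReal.ofReal ε') y :=
        lintegral_const_mul' _ _ ENNReal.ofReal_ne_top
    _ ≤ ENNReal.ofReal (δ / m) * ∫⁻ y in P '' S, (g y + ENNReal.ofReal ε') := by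
        exact mul_le_mul' le_rfl (lintegral_indicator_le _ _)
    _ = ENNReal.ofReal (δ / m) * ((∫⁻ y in P '' S, g y) + ENNReal.ofReal ε' * volume (P '' S)) := by
        rw [lintegral_add_right _ measurable_const, setLIntegral_const]
    _ ≤ ENNReal.ofReal (δ / m) *
          ((∫⁻ q in S, f q ∂(surfaceMeasure d)) + ENNReal.ofReal ε' * volume (P '' S)) := by
        gcongr
    _ = ENNReal.ofReal δ * (ENNReal.ofReal (1 / m) * (∫⁻ q in S, f q ∂(surfaceMeasure d)) +
          ENNReal.ofReal (1 / m) * (ENNReal.ofReal ε' * volume (P '' S))) := by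
        rw [div_eq_mul_one_div, ENNReal.ofReal_mul hδ.le, mul_assoc, mul_add]
    _ ≤ _ := by gcongr

end

/-! ### Layer integrals away from the critical time -/

section

variable {d : ℕ} {φ : SpaceTime d → ℝ} {t₀ T : ℝ} {c : SpaceTime d}

/-- The open time interval without a neighbourhood of the critical time. -/
def farTimes (t₀ T tc κ : ℝ) : Set ℝ := {t | t ∈ Set.Ioo t₀ T ∧ κ ≤ |t - tc|}

lemma measurableSet_farTimes (t₀ T tc κ : ℝ) : MeasurableSet (farTimes t₀ T tc κ) :=
  measurableSet_Ioo.inter (measurableSet_le (f := fun _ : ℝ => κ) (g := fun t : ℝ => |t - tc|)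
    measurable_const (by fun_prop))

lemma farTimes_subset (t₀ T tc κ : ℝ) : farTimes t₀ T tc κ ⊆ Set.Icc t₀ T :=
  fun _ h => Set.Ioo_subset_Icc_self h.1

/-- The factor `min (√κ) 1` serves the island weight and the ordinary one at once. Distance from the
critical time and a gradient bound together prevent the weight from degenerating. -/
lemma le_traceWeight {κ B m : ℝ} (hm : 0 < m) {q : SpaceTime d}
    (hq : κ ≤ |q.2 - c.2|) (hB : |timeDeriv t₀ T φ q| ≤ B) (hg : m ≤ ‖spaceGrad φ q‖) :
    min (√κ) 1 * (√(1 + (B / m) ^ 2))⁻¹ ≤ traceWeight φ t₀ T c q := by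
  have h1 : normalVelocity φ t₀ T q ^ 2 ≤ (B / m) ^ 2 := by
    rw [normalVelocity]
    refine sq_le_sq' ?_ ?_ <;> [apply neg_le_of_neg_le; skip]
    · rw [← neg_div, neg_neg]
      exact (div_le_div_of_nonneg_right ((le_abs_self _).trans hB) (norm_nonneg _)).trans
        (div_le_div_of_nonneg_left ((abs_nonneg _).trans hB) hm hg)
    · exact (div_le_div_of_nonneg_right ((neg_le_abs _).trans hB) (norm_nonneg _)).trans
        (div_le_div_of_nonneg_left ((abs_nonneg _).trans hB) hm hg)
  unfold traceWeight
  have h2 : (√(1 + (B / m) ^ 2))⁻¹ ≤ (√(1 + normalVelocity φ t₀ T q ^ 2))⁻¹ := by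
    have : 0 < √(1 + normalVelocity φ t₀ T q ^ 2) := Real.sqrt_pos.2 (by positivity)
    gcongr
  refine mul_le_mul ?_ h2 (by positivity) (by split_ifs <;> positivity)
  split_ifs
  · exact (min_le_left _ _).trans (Real.sqrt_le_sqrt hq)
  · exact min_le_right _ _

lemma exists_box_of_ne (hlt : t₀ < T) (hφ : ContDiffOn ℝ ∞ φ (Set.univ ×ˢ Set.Icc t₀ T))
    {p : SpaceTime d} (hp : p.2 ∈ Set.Icc t₀ T) {e : EuclideanSpace ℝ (Fin d)}
    (he : dirD e φ p ≠ 0) :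
    ∃ s m r : ℝ, (s = 1 ∨ s = -1) ∧ 0 < m ∧ 0 < r ∧
      ∀ q ∈ Metric.closedBall p.1 (2 * r) ×ˢ (Metric.closedBall p.2 r ∩ Set.Icc t₀ T),
        m ≤ s * dirD e φ q := by
  obtain ⟨s, hs, hs0⟩ : ∃ s : ℝ, (s = 1 ∨ s = -1) ∧ 0 < s * dirD e φ p := by
    rcases lt_or_gt_of_ne he with h | h
    · exact ⟨-1, Or.inr rfl, by linarith⟩
    · exact ⟨1, Or.inl rfl, by linarith⟩
  have hc : ContinuousWithinAt (fun q => s * dirD e φ q) (Set.univ ×ˢ Set.Icc t₀ T) p :=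
    (continuousOn_const.mul (dirD_contDiffOn hlt hφ e).continuousOn) p ⟨trivial, hp⟩
  have hn := hc (Ioi_mem_nhds (half_lt_self hs0))
  obtain ⟨ρ, hρ, hball⟩ := Metric.mem_nhdsWithin_iff.1 hn
  -- The radius `ρ / 3` leaves room for the doubled space radius inside the ball of radius `ρ`.
  refine ⟨s, s * dirD e φ p / 2, ρ / 3, hs, by linarith, by linarith, ?_⟩
  rintro q ⟨h1, h2, h3⟩
  have h4 : q ∈ Metric.ball p ρ := by
    rw [Metric.mem_ball, Prod.dist_eq, max_lt_iff]
    rw [Metric.mem_closedBall] at h1 h2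
    constructor <;> linarith
  exact le_of_lt (hball ⟨h4, trivial, h3⟩)

/-- The integral over the layer `{-δ ≤ φ < 0}`, away from the critical time, is asymptotically
bounded by `δ` times the weighted trace integral. -/
lemma exists_lintegral_tube_le (hφ : IsLevelSetEvolution φ t₀ T c) (R : ℝ)
    (hR : ∀ t ∈ Set.Icc t₀ T, ∀ x ∈ Omega φ t, ‖x‖ ≤ R) {κ : ℝ} (hκ : 0 < κ) :
    ∃ C : ℝ, ∀ w : SpaceTime d → ℝ, Continuous w → ∀ ε : ℝ, 0 < ε → ∀ᶠ δ in 𝓝[>] (0 : ℝ),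
      ∫⁻ q in tube φ (farTimes t₀ T c.2 κ) δ, ENNReal.ofReal (w q ^ 2) ≤
        ENNReal.ofReal δ * (ENNReal.ofReal C * (∫⁻ q in spatialBoundary φ t₀ T,
          ENNReal.ofReal (traceWeight φ t₀ T c q * w q ^ 2) ∂(surfaceMeasure d)) +
          ENNReal.ofReal ε) := by
  have hlt := hφ.lt
  set I := farTimes t₀ T c.2 κ with hIdef
  have hI : MeasurableSet I := measurableSet_farTimes _ _ _ _
  have hIs : I ⊆ Set.Icc t₀ T := farTimes_subset _ _ _ _
  set Tr : (SpaceTime d → ℝ) → ℝ≥0∞ := fun w => ∫⁻ q in spatialBoundary φ t₀ T,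
          ENNReal.ofReal (traceWeight φ t₀ T c q * w q ^ 2) ∂(surfaceMeasure d) with hTr
  set K : Set (SpaceTime d) :=
    Metric.closedBall 0 R ×ˢ (Set.Icc t₀ T ∩ {t | κ ≤ |t - c.2|}) with hKdef
  have hK : IsCompact K := by
    refine (isCompact_closedBall _ _).prod (isCompact_Icc.inter_right ?_)
    exact isClosed_le continuous_const (by fun_prop)
  have hcov : ∀ p ∈ K, ∃ N ∈ 𝓝[K] p, ∃ C : ℝ, 0 ≤ C ∧ ∀ w : SpaceTime d → ℝ, Continuous w →
      ∀ ε : ℝ, 0 < ε → ∀ᶠ δ in 𝓝[>] (0 : ℝ),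
      ∫⁻ q in (N ∩ K) ∩ tube φ I δ, ENNReal.ofReal (w q ^ 2) ≤
        ENNReal.ofReal δ * (ENNReal.ofReal C * Tr w + ENNReal.ofReal ε) := by
    intro p hp
    have hpI : p.2 ∈ Set.Icc t₀ T := hp.2.1
    -- A zero in `K` is not the critical point, as its time is at least `κ` away from the critical
    -- time, so some space derivative is nonzero there. Around a point with `φ p ≠ 0` the layer is
    -- empty for small `δ`.
    by_cases h0 : φ p = 0
    · have hne : p ≠ c := by
        rintro rfl
        have : κ ≤ |p.2 - p.2| := hp.2.2
        rw [sub_self, abs_zero] at this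
        linarith
      have hg := hφ.isolated p.2 hpI p.1 h0 hne
      obtain ⟨i, hi⟩ : ∃ i, dirD (stdVec i) φ p ≠ 0 := by
        by_contra! hall
        apply hg
        ext i
        rw [spaceGrad_apply]
        exact hall i
      obtain ⟨s, m, r, hs, hm0, hr, hm⟩ := exists_box_of_ne hlt hφ.smooth hpI hi
      set J := Metric.closedBall p.2 r ∩ Set.Icc t₀ T with hJdef
      have hJ : IsCompact J := (isCompact_closedBall _ _).inter_right isClosed_Icc
      obtain ⟨B, hB⟩ := ((isCompact_closedBall p.1 (2 * r)).prod hJ).exists_bound_of_continuousOn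
        ((timeDeriv_continuousOn hlt hφ.smooth).mono (fun q hq => ⟨trivial, hq.2.2⟩))
      -- This positive lower bound of the trace weight on the part of the zero level in the box
      -- converts the unweighted surface integral into the weighted one.
      set ω₀ := min (√κ) 1 * (√(1 + (B / m) ^ 2))⁻¹ with hω₀
      have hω₀pos : 0 < ω₀ := by
        have : 0 < √κ := Real.sqrt_pos.2 hκ
        have : 0 < √(1 + (B / m) ^ 2) := Real.sqrt_pos.2 (by positivity)
        positivity
      refine ⟨Metric.closedBall p.1 r ×ˢ Metric.closedBall p.2 r, ?_, 1 / m * (1 / ω₀),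
        by positivity, ?_⟩
      · exact nhdsWithin_le_nhds (prod_mem_nhds (Metric.closedBall_mem_nhds _ hr)
          (Metric.closedBall_mem_nhds _ hr))
      intro w hw ε hε
      filter_upwards [lintegral_tube_box_le hφ.smooth hI hIs hJ hs hm0 hr (fun q hq _ => hm q hq)
        hw hε, self_mem_nhdsWithin] with δ hδ _
      refine le_trans (lintegral_mono_set ?_) (hδ.trans ?_)
      · rintro q ⟨⟨⟨h1, h2⟩, h3⟩, h4⟩
        exact ⟨⟨h1, h2, h3.2.1⟩, h4⟩
      · have hS : ∀ q ∈ {q | q ∈ Metric.closedBall p.1 (2 * r) ×ˢ J ∧ q.2 ∈ I ∧ φ q = 0},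
            ENNReal.ofReal (w q ^ 2) ≤
              ENNReal.ofReal (1 / ω₀) * ENNReal.ofReal (traceWeight φ t₀ T c q * w q ^ 2) := by
          rintro q ⟨h1, h2, h3⟩
          rw [← ENNReal.ofReal_mul (by positivity)]
          refine ENNReal.ofReal_le_ofReal ?_
          have hgm : m ≤ ‖spaceGrad φ q‖ := by
            have h5 : |spaceGrad φ q i| ≤ ‖spaceGrad φ q‖ := by
              simpa using PiLp.norm_apply_le (spaceGrad φ q) i
            rw [spaceGrad_apply] at h5
            refine (hm q h1).trans (le_trans ?_ h5)
            refine (le_abs_self _).trans ?_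
            rw [abs_mul]
            rcases hs with rfl | rfl <;> simp
          have h6 := le_traceWeight (c := c) hm0 h2.2 (hB q h1) hgm
          rw [← hω₀] at h6
          rw [one_div, inv_mul_eq_div, le_div_iff₀ hω₀pos, mul_comm]
          gcongr
        have hSm : MeasurableSet
            {q | q ∈ Metric.closedBall p.1 (2 * r) ×ˢ J ∧ q.2 ∈ I ∧ φ q = 0} := by
          have : {q | q ∈ Metric.closedBall p.1 (2 * r) ×ˢ J ∧ q.2 ∈ I ∧ φ q = 0} =
              ((Metric.closedBall p.1 (2 * r) ×ˢ J) ∩ Prod.snd ⁻¹' I) ∩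
                ((Set.univ ×ˢ Set.Icc t₀ T) ∩ φ ⁻¹' {0}) := by
            ext q
            simp only [Set.mem_ofPred_eq, Set.mem_inter_iff, Set.mem_preimage, Set.mem_prod,
              Set.mem_univ, true_and, Set.mem_singleton_iff]
            refine ⟨fun h => ⟨⟨h.1, h.2.1⟩, hIs h.2.1, h.2.2⟩,
              fun h => ⟨h.1.1, h.1.2, h.2.2⟩⟩
          rw [this]
          exact ((((isCompact_closedBall _ _).prod hJ).measurableSet).inter
            (measurable_snd hI)).inter
            (isClosed_slab_inter hφ.smooth.continuousOn isClosed_singleton).measurableSet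
        have hle : ∫⁻ q in {q | q ∈ Metric.closedBall p.1 (2 * r) ×ˢ J ∧ q.2 ∈ I ∧ φ q = 0},
            ENNReal.ofReal (w q ^ 2) ∂(surfaceMeasure d) ≤ ENNReal.ofReal (1 / ω₀) * Tr w := by
          refine (setLIntegral_mono' hSm hS).trans ?_
          rw [lintegral_const_mul' _ _ ENNReal.ofReal_ne_top]
          refine mul_le_mul' le_rfl (lintegral_mono_set ?_)
          rintro q ⟨-, h2, h3⟩
          exact ⟨h2.1, h3⟩
        rw [ENNReal.ofReal_mul (by positivity : 0 ≤ 1 / m), mul_assoc]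
        gcongr
    · have hc := (hφ.smooth.continuousOn.abs) p ⟨trivial, hpI⟩
      have hpos : 0 < |φ p| := abs_pos.2 h0
      have hn := hc (Ioi_mem_nhds (half_lt_self hpos))
      refine ⟨_, nhdsWithin_mono p (show K ⊆ Set.univ ×ˢ Set.Icc t₀ T from
        fun q hq => ⟨trivial, hq.2.1⟩) hn, 0, le_rfl, ?_⟩
      intro w hw ε hε
      filter_upwards [nhdsWithin_le_nhds (gt_mem_nhds (half_pos hpos))] with δ hδ
      have : (((fun x => |φ x|) ⁻¹' Set.Ioi (|φ p| / 2)) ∩ K) ∩ tube φ I δ = ∅ := by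
        rw [Set.eq_empty_iff_forall_notMem]
        rintro q ⟨⟨h1, -⟩, -, h2, h3⟩
        simp only [Set.mem_preimage, Set.mem_Ioi] at h1
        rw [abs_of_neg h3] at h1
        linarith
      rw [this]
      simp
  obtain ⟨C, -, hC⟩ := hK.induction_on (p := fun N => ∃ C : ℝ, 0 ≤ C ∧ ∀ w : SpaceTime d → ℝ,
      Continuous w → ∀ ε : ℝ, 0 < ε → ∀ᶠ δ in 𝓝[>] (0 : ℝ),
      ∫⁻ q in (N ∩ K) ∩ tube φ I δ, ENNReal.ofReal (w q ^ 2) ≤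
        ENNReal.ofReal δ * (ENNReal.ofReal C * Tr w + ENNReal.ofReal ε))
    ⟨0, le_rfl, fun w hw ε hε => Eventually.of_forall fun δ => by simp⟩
    (fun N N' hN ⟨C, h0, h⟩ => ⟨C, h0, fun w hw ε hε => by
      filter_upwards [h w hw ε hε] with δ hδ
      refine le_trans (lintegral_mono_set ?_) hδ
      exact fun q hq => ⟨⟨hN hq.1.1, hq.1.2⟩, hq.2⟩⟩)
    (fun N N' ⟨C, h0, h⟩ ⟨C', h0', h'⟩ => ⟨C + C', by positivity, fun w hw ε hε => by
      filter_upwards [h w hw (ε / 2) (half_pos hε), h' w hw (ε / 2) (half_pos hε)]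
        with δ hδ hδ'
      have : ((N ∪ N') ∩ K) ∩ tube φ I δ = ((N ∩ K) ∩ tube φ I δ) ∪ ((N' ∩ K) ∩ tube φ I δ) := by
        rw [Set.union_inter_distrib_right, Set.union_inter_distrib_right]
      rw [this]
      refine (lintegral_union_le _ _ _).trans ((add_le_add hδ hδ').trans (le_of_eq ?_))
      rw [ENNReal.ofReal_add h0 h0', ← mul_add]
      have : ENNReal.ofReal ε = ENNReal.ofReal (ε / 2) + ENNReal.ofReal (ε / 2) := by
        rw [← ENNReal.ofReal_add (by positivity) (by positivity), add_halves]
      rw [this]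
      ring⟩) hcov
  refine ⟨C, fun w hw ε hε => ?_⟩
  filter_upwards [hC w hw ε hε] with δ hδ
  refine le_trans (lintegral_mono_set ?_) hδ
  intro q hq
  have hqK : q ∈ K :=
    ⟨by simpa using hR q.2 (hIs hq.1) q.1 hq.2.2, hIs hq.1, hq.1.2⟩
  exact ⟨⟨hqK, hqK⟩, hq⟩

end

/-! ### The regularized Hardy inequality for smooth functions -/

section

variable {d : ℕ} {φ : SpaceTime d → ℝ} {t₀ T R : ℝ} {c : SpaceTime d}

/-- The weight `|∇φ|² / (η - φ)²` of the regularized Hardy inequality. -/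
noncomputable def hardyWeight (φ : SpaceTime d → ℝ) (η : ℝ) (q : SpaceTime d) : ℝ :=
  ‖spaceGrad φ q‖ ^ 2 * ((η - φ q)⁻¹) ^ 2

lemma hardyWeight_nonneg (φ : SpaceTime d → ℝ) (η : ℝ) (q : SpaceTime d) :
    0 ≤ hardyWeight φ η q := by unfold hardyWeight; positivity

lemma ofReal_sq_eq_enorm (x : ℝ) : ENNReal.ofReal (x ^ 2) = ‖x‖ₑ ^ 2 := by
  rw [← sq_abs, ENNReal.ofReal_pow (abs_nonneg _), ← Real.enorm_eq_ofReal_abs]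

lemma ofReal_norm_sq_eq_enorm {E : Type*} [NormedAddCommGroup E] (x : E) :
    ENNReal.ofReal (‖x‖ ^ 2) = ‖x‖ₑ ^ 2 := by
  rw [ENNReal.ofReal_pow (norm_nonneg _), ofReal_norm]

lemma continuousOn_hardyWeight (hlt : t₀ < T)
    (hφ : ContDiffOn ℝ ∞ φ (Set.univ ×ˢ Set.Icc t₀ T)) {η : ℝ} (hη : 0 < η) :
    ContinuousOn (hardyWeight φ η) (closedDomain φ t₀ T R) := by
  have hs := closedDomain_subset_slab (φ := φ) (t₀ := t₀) (T := T) (R := R)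
  refine ContinuousOn.mul ((((continuousOn_spaceGrad hlt hφ).mono hs).norm).pow 2) ?_
  refine ContinuousOn.pow (ContinuousOn.inv₀ (continuousOn_const.sub
    (hφ.continuousOn.mono hs)) fun q hq => ?_) 2
  have : φ q ≤ 0 := hq.2
  have : 0 < η - φ q := by linarith
  exact this.ne'

/-- The regularized Hardy inequality for smooth functions. -/
lemma exists_hardy_smooth (hφ : IsLevelSetEvolution φ t₀ T c) (hcase : ¬ IsHoleOrVoidCase φ c)
    (hR : ∀ t ∈ Set.Icc t₀ T, ∀ x ∈ Omega φ t, ‖x‖ ≤ R) :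
    ∃ C : ℝ, ∀ η : ℝ, 0 < η → ∀ κ : ℝ, 0 < κ → ∃ C' : ℝ, ∀ w : SpaceTime d → ℝ,
      ContDiff ℝ ∞ w →
      ∫⁻ q in subDomain φ (farTimes t₀ T c.2 κ),
          ENNReal.ofReal (hardyWeight φ η q) * ‖w q‖ₑ ^ 2 ≤
        ENNReal.ofReal C * (∫⁻ q in spaceTimeDomain φ t₀ T, (‖w q‖ₑ ^ 2 + ‖spaceGrad w q‖ₑ ^ 2)) +
        ENNReal.ofReal C' * (∫⁻ q in spatialBoundary φ t₀ T,
          ENNReal.ofReal (traceWeight φ t₀ T c q * w q ^ 2) ∂(surfaceMeasure d)) := by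
  obtain ⟨C, hC0, hC⟩ := exists_hardy_energy hφ hcase hR
  refine ⟨C, fun η hη κ hκ => ?_⟩
  obtain ⟨C₁, hC₁0, hC₁⟩ := hC η hη
  obtain ⟨C₂, hC₂⟩ := exists_lintegral_tube_le hφ R hR hκ
  -- The factor `C₁ / δ` of the layer term cancels the factor `δ` in the layer estimate.
  refine ⟨C₁ * C₂, fun w hw => ?_⟩
  set I := farTimes t₀ T c.2 κ with hIdef
  have hI : MeasurableSet I := measurableSet_farTimes _ _ _ _
  have hIs : I ⊆ Set.Icc t₀ T := farTimes_subset _ _ _ _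
  have hφc := hφ.smooth.continuousOn
  have hm := measurableSet_subDomain hφc hI hIs
  set Tr : ℝ≥0∞ := ∫⁻ q in spatialBoundary φ t₀ T,
          ENNReal.ofReal (traceWeight φ t₀ T c q * w q ^ 2) ∂(surfaceMeasure d) with hTr
  have hs := closedDomain_subset_slab (φ := φ) (t₀ := t₀) (T := T) (R := R)
  have cw : ContinuousOn w (closedDomain φ t₀ T R) := hw.continuous.continuousOn
  have cgw : ContinuousOn (fun q => ‖spaceGrad w q‖ ^ 2) (closedDomain φ t₀ T R) :=
    ((continuous_spaceGrad hw).norm.pow 2).continuousOn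
  set F : ℝ → SpaceTime d → ℝ := fun δ q => Real.smoothTransition (-φ q / δ) *
      (‖spaceGrad φ q‖ ^ 2 * w q ^ 2 * ((η - φ q)⁻¹) ^ 2) with hF
  have hFeq : ∀ δ, F δ = fun q => Real.smoothTransition (-φ q / δ) *
      (hardyWeight φ η q * w q ^ 2) := by
    intro δ; ext q; simp only [hF, hardyWeight]; ring
  have cF : ∀ δ, ContinuousOn (F δ) (closedDomain φ t₀ T R) := by
    intro δ
    rw [hFeq]
    exact (Real.smoothTransition.continuous.comp_continuousOn
      ((hφc.mono hs).neg.div_const δ)).mul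
      ((continuousOn_hardyWeight hφ.lt hφ.smooth hη).mul (cw.pow 2))
  have iF : ∀ δ, IntegrableOn (F δ) (subDomain φ I) := fun δ =>
    integrableOn_subDomain hφc hR hIs (cF δ)
  have hF0 : ∀ δ q, 0 ≤ F δ q := fun δ q =>
    mul_nonneg (Real.smoothTransition.nonneg _) (by positivity)
  have iW : IntegrableOn (fun q => w q ^ 2 + ‖spaceGrad w q‖ ^ 2) (subDomain φ I) :=
    integrableOn_subDomain hφc hR hIs ((cw.pow 2).add cgw)
  set A := ENNReal.ofReal C *
    (∫⁻ q in spaceTimeDomain φ t₀ T, (‖w q‖ₑ ^ 2 + ‖spaceGrad w q‖ₑ ^ 2)) with hA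
  have hstep : ∀ ε : ℝ, 0 < ε → ∀ᶠ δ in 𝓝[>] (0 : ℝ),
      ∫⁻ q in subDomain φ I, ENNReal.ofReal (F δ q) ≤
        A + ENNReal.ofReal C₁ * (ENNReal.ofReal C₂ * Tr + ENNReal.ofReal ε) := by
    intro ε hε
    filter_upwards [hC₂ w hw.continuous ε hε, self_mem_nhdsWithin] with δ hδ hδ0
    have hδ0 : 0 < δ := hδ0
    have iw : IntegrableOn (fun q => w q ^ 2) (tube φ I δ) :=
      (integrableOn_subDomain hφc hR hIs (cw.pow 2)).mono_set (tube_subset_subDomain φ I δ)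
    have h1 := hC₁ I hI hIs w hw δ hδ0
    rw [← ofReal_integral_eq_lintegral_ofReal (iF δ) (Eventually.of_forall (hF0 δ))]
    refine (ENNReal.ofReal_le_ofReal h1).trans ?_
    have n1 : 0 ≤ ∫ q in subDomain φ I, (w q ^ 2 + ‖spaceGrad w q‖ ^ 2) :=
      integral_nonneg fun q => by positivity
    have n2 : 0 ≤ ∫ q in tube φ I δ, w q ^ 2 := integral_nonneg fun q => by positivity
    rw [ENNReal.ofReal_add (by positivity) (by positivity), ENNReal.ofReal_mul hC0,
      ENNReal.ofReal_mul (by positivity : 0 ≤ C₁ / δ),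
      ofReal_integral_eq_lintegral_ofReal iW (Eventually.of_forall fun q => by positivity),
      ofReal_integral_eq_lintegral_ofReal iw (Eventually.of_forall fun q => by positivity)]
    refine add_le_add (mul_le_mul' le_rfl ?_) ?_
    · refine (lintegral_mono_set (?_ : subDomain φ I ⊆ spaceTimeDomain φ t₀ T)).trans
        (le_of_eq (lintegral_congr fun q => ?_))
      · exact fun q hq => ⟨hq.1.1, hq.2⟩
      · rw [ENNReal.ofReal_add (by positivity) (by positivity), ofReal_norm_sq_eq_enorm,
          ofReal_sq_eq_enorm]
    · refine (mul_le_mul' le_rfl hδ).trans (le_of_eq ?_)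
      rw [← mul_assoc, ← ENNReal.ofReal_mul (by positivity : 0 ≤ C₁ / δ),
        div_mul_cancel₀ _ hδ0.ne']
  have hseq : Tendsto (fun n : ℕ => 1 / ((n : ℝ) + 1)) atTop (𝓝[>] 0) :=
    tendsto_nhdsWithin_iff.2 ⟨tendsto_one_div_add_atTop_nhds_zero_nat,
      Eventually.of_forall fun n => by simp only [Set.mem_Ioi]; positivity⟩
  -- At a fixed point the step equals `1` as soon as `δ ≤ -φ`, so Fatou's lemma along `δ = 1/(n+1)`
  -- recovers the weight without cut-off.
  have hlim : ∀ q ∈ subDomain φ I, ENNReal.ofReal (hardyWeight φ η q) * ‖w q‖ₑ ^ 2 ≤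
      liminf (fun n : ℕ => ENNReal.ofReal (F (1 / ((n : ℝ) + 1)) q)) atTop := by
    intro q hq
    have hq0 : φ q < 0 := hq.2
    refine le_liminf_of_le (by isBoundedDefault) ?_
    have h1 : ∀ᶠ δ in 𝓝[>] (0 : ℝ), ENNReal.ofReal (hardyWeight φ η q) * ‖w q‖ₑ ^ 2 ≤
        ENNReal.ofReal (F δ q) := by
      filter_upwards [self_mem_nhdsWithin, nhdsWithin_le_nhds (gt_mem_nhds (neg_pos.2 hq0))]
        with δ hδ0 hδ
      have hδ0 : 0 < δ := hδ0
      rw [hFeq]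
      simp only
      rw [Real.smoothTransition.one_of_one_le (by rw [le_div_iff₀ hδ0]; linarith), one_mul,
        ENNReal.ofReal_mul (hardyWeight_nonneg _ _ _), ofReal_sq_eq_enorm]
    exact hseq.eventually h1
  have hbound : ∀ ε : ℝ, 0 < ε → ∫⁻ q in subDomain φ I,
      ENNReal.ofReal (hardyWeight φ η q) * ‖w q‖ₑ ^ 2 ≤
        A + ENNReal.ofReal C₁ * (ENNReal.ofReal C₂ * Tr + ENNReal.ofReal ε) := by
    intro ε hε
    refine (setLIntegral_mono' hm hlim).trans ?_
    refine (lintegral_liminf_le' fun n => ?_).trans ?_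
    · exact (iF _).aestronglyMeasurable.aemeasurable.ennreal_ofReal
    · refine liminf_le_of_frequently_le ?_ (by isBoundedDefault)
      exact (hseq.eventually (hstep ε hε)).frequently
  rw [ENNReal.ofReal_mul hC₁0]
  -- The auxiliary `ε` of the layer estimate is removed. Dividing by `C₁ + 1` compensates for its
  -- factor `C₁`.
  refine ENNReal.le_of_forall_pos_le_add fun ε hε _ => ?_
  refine (hbound (ε / (C₁ + 1)) (by positivity)).trans ?_
  rw [mul_add, ← add_assoc, mul_assoc]
  refine add_le_add le_rfl ?_
  rw [← ENNReal.ofReal_mul hC₁0, ← ENNReal.ofReal_coe_nnreal]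
  refine ENNReal.ofReal_le_ofReal ?_
  have h1 : C₁ * (ε / (C₁ + 1)) = ε * (C₁ / (C₁ + 1)) := by field_simp
  rw [h1]
  have h2 : C₁ / (C₁ + 1) ≤ 1 := by rw [div_le_one (by positivity)]; linarith
  exact mul_le_of_le_one_right ε.2 h2

end

/-! ### Calculus of weak spatial gradients -/

section

variable {d : ℕ} {Q : Set (SpaceTime d)}

lemma dirD_of_notMem_tsupport {f : SpaceTime d → ℝ} {q : SpaceTime d} (hq : q ∉ tsupport f)
    (e : EuclideanSpace ℝ (Fin d)) : dirD e f q = 0 := by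
  have h1 := notMem_tsupport_iff_eventuallyEq.1 hq
  have h2 : (fun y => f (y, q.2)) =ᶠ[𝓝 q.1] fun _ => (0 : ℝ) :=
    (Continuous.prodMk_left q.2).continuousAt.eventually h1
  unfold dirD
  rw [h2.fderiv_eq]
  simp

lemma dirD_eq_fderiv {f : SpaceTime d → ℝ} {q : SpaceTime d} (hf : DifferentiableAt ℝ f q)
    (e : EuclideanSpace ℝ (Fin d)) : dirD e f q = fderiv ℝ f q (e, 0) := by
  have h3 : HasFDerivAt f (fderiv ℝ f q) (q.1, q.2) := hf.hasFDerivAt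
  have h4 := h3.comp q.1 (hasFDerivAt_mk_left q.1 q.2)
  unfold dirD
  rw [show (fun y => f (y, q.2)) = f ∘ fun y => (y, q.2) from rfl, h4.fderiv]
  simp

lemma differentiableAt_slice {f : SpaceTime d → ℝ} {q : SpaceTime d}
    (hf : DifferentiableAt ℝ f q) : DifferentiableAt ℝ (fun y => f (y, q.2)) q.1 := by
  have h3 : HasFDerivAt f (fderiv ℝ f q) (q.1, q.2) := hf.hasFDerivAt
  exact (h3.comp q.1 (hasFDerivAt_mk_left q.1 q.2)).differentiableAt

lemma dirD_mul {f g : SpaceTime d → ℝ} {q : SpaceTime d} (hf : DifferentiableAt ℝ f q)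
    (hg : DifferentiableAt ℝ g q) (e : EuclideanSpace ℝ (Fin d)) :
    dirD e (f * g) q = f q * dirD e g q + g q * dirD e f q := by
  rw [dirD_eq_fderiv (hf.mul hg), dirD_eq_fderiv hf, dirD_eq_fderiv hg, fderiv_mul hf hg]
  simp

lemma continuousOn_dirD (hQ : IsOpen Q) {f : SpaceTime d → ℝ} (hf : ContDiffOn ℝ ∞ f Q)
    (e : EuclideanSpace ℝ (Fin d)) : ContinuousOn (dirD e f) Q := by
  have h1 : ContinuousOn (fun q => fderiv ℝ f q (e, 0)) Q :=
    (hf.continuousOn_fderiv_of_isOpen hQ (by simp)).clm_apply continuousOn_const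
  exact h1.congr fun q hq =>
    dirD_eq_fderiv ((hf.contDiffAt (hQ.mem_nhds hq)).differentiableAt (by simp)) e

lemma memLp_mul_of_tsupport_subset (hQ : IsOpen Q) {ξ f : SpaceTime d → ℝ} (hξ : Continuous ξ)
    (hξc : HasCompactSupport ξ) (hξQ : tsupport ξ ⊆ Q) (hf : ContinuousOn f Q) :
    MemLp (ξ * f) 2 (volume.restrict Q) := by
  have hs : tsupport (ξ * f) ⊆ Q := tsupport_mul_subset_left.trans hξQ
  have h1 : Continuous (ξ * f) :=
    (hξ.continuousOn.mul hf).continuous_of_tsupport_subset hQ hs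
  exact (h1.memLp_of_hasCompactSupport hξc.mul_right).restrict Q

lemma tsupport_dirD_subset (ξ : SpaceTime d → ℝ) (e : EuclideanSpace ℝ (Fin d)) :
    tsupport (dirD e ξ) ⊆ tsupport ξ :=
  closure_minimal (fun q hq => by
    by_contra h
    exact hq (dirD_of_notMem_tsupport h e)) (isClosed_tsupport ξ)

lemma memLp_dirD_of_hasCompactSupport {ξ : SpaceTime d → ℝ} (hξ : ContDiff ℝ ∞ ξ)
    (hξc : HasCompactSupport ξ) (e : EuclideanSpace ℝ (Fin d)) :
    MemLp (dirD e ξ) 2 (volume.restrict Q) :=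
  ((dirD_contDiff hξ e).continuous.memLp_of_hasCompactSupport
    (hξc.of_isClosed_subset (isClosed_tsupport _) (tsupport_dirD_subset ξ e))).restrict Q


/-- This is the fundamental lemma of the calculus of variations, applied to each component. It makes
the choice in `weakSpaceGrad` immaterial, so norms in `H` can be computed from any square integrable
weak gradient. -/
lemma IsWeakSpaceGrad.ae_eq (hQ : IsOpen Q) {u : SpaceTime d → ℝ}
    {g₁ g₂ : SpaceTime d → EuclideanSpace ℝ (Fin d)} (hg₁ : MemLp g₁ 2 (volume.restrict Q))
    (hg₂ : MemLp g₂ 2 (volume.restrict Q)) (h₁ : IsWeakSpaceGrad Q u g₁)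
    (h₂ : IsWeakSpaceGrad Q u g₂) : g₁ =ᵐ[volume.restrict Q] g₂ := by
  have hi : ∀ i, ∀ᵐ q ∂(volume.restrict Q), g₁ q i = g₂ q i := by
    intro i
    have l₁ := hg₁.eval_piLp i
    have l₂ := hg₂.eval_piLp i
    have hloc : LocallyIntegrableOn (fun q => g₁ q i - g₂ q i) Q := by
      have : LocallyIntegrable (fun q => g₁ q i - g₂ q i) (volume.restrict Q) :=
        (l₁.sub l₂).locallyIntegrable (by norm_num)
      exact locallyIntegrableOn_of_locallyIntegrable_restrict this
    have := hQ.ae_eq_zero_of_integral_contDiff_smul_eq_zero hloc fun ξ h1 h2 h3 => ?_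
    · rw [ae_restrict_iff' hQ.measurableSet]
      filter_upwards [this] with q hq hqQ
      exact sub_eq_zero.1 (hq hqQ)
    have e1 := h₁ ξ h1 h2 h3 i
    have e2 := h₂ ξ h1 h2 h3 i
    have mξ : MemLp ξ 2 (volume.restrict Q) :=
      (h1.continuous.memLp_of_hasCompactSupport h2).restrict Q
    have i1 : Integrable (fun q => g₁ q i * ξ q) (volume.restrict Q) := l₁.integrable_mul mξ
    have i2 : Integrable (fun q => g₂ q i * ξ q) (volume.restrict Q) := l₂.integrable_mul mξ
    have e3 : ∫ q in Q, ξ q • (g₁ q i - g₂ q i) = 0 := by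
      have : ∀ q, ξ q • (g₁ q i - g₂ q i) = g₁ q i * ξ q - g₂ q i * ξ q := fun q => by
        rw [smul_eq_mul]; ring
      simp only [this]
      rw [integral_sub i1 i2]
      linarith
    rw [← e3]
    refine (setIntegral_eq_integral_of_forall_compl_eq_zero fun q hq => ?_).symm
    rw [image_eq_zero_of_notMem_tsupport fun h => hq (h3 h), zero_smul]
  filter_upwards [ae_all_iff.2 hi] with q hq
  ext i
  exact hq i

lemma IsWeakSpaceGrad.sub {u u' : SpaceTime d → ℝ}
    {g g' : SpaceTime d → EuclideanSpace ℝ (Fin d)} (hu : MemLp u 2 (volume.restrict Q))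
    (hu' : MemLp u' 2 (volume.restrict Q)) (hg : MemLp g 2 (volume.restrict Q))
    (hg' : MemLp g' 2 (volume.restrict Q)) (h : IsWeakSpaceGrad Q u g)
    (h' : IsWeakSpaceGrad Q u' g') : IsWeakSpaceGrad Q (u - u') (g - g') := by
  intro ξ h1 h2 h3 i
  have mξ : MemLp ξ 2 (volume.restrict Q) :=
    (h1.continuous.memLp_of_hasCompactSupport h2).restrict Q
  have mD : MemLp (fun q => spaceGrad ξ q i) 2 (volume.restrict Q) := by
    simp only [spaceGrad_apply]
    exact memLp_dirD_of_hasCompactSupport h1 h2 _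
  have i1 : Integrable (fun q => u q * spaceGrad ξ q i) (volume.restrict Q) := hu.integrable_mul mD
  have i2 : Integrable (fun q => u' q * spaceGrad ξ q i) (volume.restrict Q) :=
    hu'.integrable_mul mD
  have i3 : Integrable (fun q => g q i * ξ q) (volume.restrict Q) :=
    (hg.eval_piLp i).integrable_mul mξ
  have i4 : Integrable (fun q => g' q i * ξ q) (volume.restrict Q) :=
    (hg'.eval_piLp i).integrable_mul mξ
  simp only [Pi.sub_apply, PiLp.sub_apply, sub_mul]
  rw [integral_sub i1 i2, integral_sub i3 i4, h ξ h1 h2 h3 i, h' ξ h1 h2 h3 i]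
  ring

lemma isWeakSpaceGrad_of_contDiff {w : SpaceTime d → ℝ} (hw : ContDiff ℝ ∞ w) :
    IsWeakSpaceGrad Q w (spaceGrad w) := by
  intro ξ h1 h2 h3 i
  simp only [spaceGrad_apply]
  have hdw : Differentiable ℝ w := hw.differentiable (by simp)
  have hdξ : Differentiable ℝ ξ := h1.differentiable (by simp)
  have c1 : HasCompactSupport (dirD (stdVec i) ξ) :=
    h2.of_isClosed_subset (isClosed_tsupport _) (tsupport_dirD_subset ξ _)
  have i1 : Integrable (fun q => w q * dirD (stdVec i) ξ q) :=
    (hw.continuous.mul (dirD_contDiff h1 _).continuous).integrable_of_hasCompactSupport c1.mul_left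
  have i2 : Integrable (fun q => dirD (stdVec i) w q * ξ q) :=
    ((dirD_contDiff hw _).continuous.mul h1.continuous).integrable_of_hasCompactSupport h2.mul_left
  have i3 : Integrable (fun q => w q * ξ q) :=
    (hw.continuous.mul h1.continuous).integrable_of_hasCompactSupport h2.mul_left
  rw [setIntegral_eq_integral_of_forall_compl_eq_zero fun q hq => by
      rw [dirD_of_notMem_tsupport fun h => hq (h3 h), mul_zero],
    setIntegral_eq_integral_of_forall_compl_eq_zero fun q hq => by
      rw [image_eq_zero_of_notMem_tsupport fun h => hq (h3 h), mul_zero]]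
  have h0 := integral_eq_zero_of_hasLineDerivAt (F := fun q => w q * ξ q)
    (F' := fun q => w q * dirD (stdVec i) ξ q + dirD (stdVec i) w q * ξ q)
    (v := (stdVec i, 0)) i3 (i1.add i2) fun q => by
      have := hasLineDerivAt_dirD (differentiableAt_slice ((hdw q).mul (hdξ q))) (stdVec i)
      rw [dirD_mul (hdw q) (hdξ q), mul_comm (ξ q)] at this
      exact this
  rw [integral_add i1 i2] at h0
  linarith

lemma contDiff_mul_of_tsupport_subset (hQ : IsOpen Q) {ξ f : SpaceTime d → ℝ}
    (hξ : ContDiff ℝ ∞ ξ) (hξQ : tsupport ξ ⊆ Q) (hf : ContDiffOn ℝ ∞ f Q) :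
    ContDiff ℝ ∞ (ξ * f) := by
  refine contDiff_iff_contDiffAt.2 fun q => ?_
  by_cases hq : q ∈ tsupport (ξ * f)
  swap
  · exact contDiffAt_const.congr_of_eventuallyEq (notMem_tsupport_iff_eventuallyEq.1 hq)
  exact hξ.contDiffAt.mul (hf.contDiffAt (hQ.mem_nhds (hξQ (tsupport_mul_subset_left hq))))

/-- The product rule for weak gradients, with one smooth factor. -/
lemma IsWeakSpaceGrad.smooth_mul (hQ : IsOpen Q) {u θ : SpaceTime d → ℝ}
    {g : SpaceTime d → EuclideanSpace ℝ (Fin d)} (hu : MemLp u 2 (volume.restrict Q))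
    (hg : MemLp g 2 (volume.restrict Q)) (h : IsWeakSpaceGrad Q u g)
    (hθ : ContDiffOn ℝ ∞ θ Q) :
    IsWeakSpaceGrad Q (θ * u) (fun q => θ q • g q + u q • spaceGrad θ q) := by
  intro ξ h1 h2 h3 i
  -- The weak gradient of `u` is tested with `ξ θ`, a legitimate test function although `θ` is
  -- smooth only inside `Q`.
  have hm := contDiff_mul_of_tsupport_subset hQ h1 h3 hθ
  have hc : HasCompactSupport (ξ * θ) := h2.mul_right
  have hs : tsupport (ξ * θ) ⊆ Q := tsupport_mul_subset_left.trans h3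
  have e1 := h (ξ * θ) hm hc hs i
  simp only [spaceGrad_apply] at e1 ⊢
  have hD : ∀ q ∈ Q, dirD (stdVec i) (ξ * θ) q =
      ξ q * dirD (stdVec i) θ q + θ q * dirD (stdVec i) ξ q := fun q hq =>
    dirD_mul (h1.differentiable (by simp) q)
      ((hθ.contDiffAt (hQ.mem_nhds hq)).differentiableAt (by simp)) _
  have m1 : MemLp (ξ * dirD (stdVec i) θ) 2 (volume.restrict Q) :=
    memLp_mul_of_tsupport_subset hQ h1.continuous h2 h3 (continuousOn_dirD hQ hθ _)
  have m2 : MemLp (dirD (stdVec i) ξ * θ) 2 (volume.restrict Q) :=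
    memLp_mul_of_tsupport_subset hQ (dirD_contDiff h1 _).continuous
      (h2.of_isClosed_subset (isClosed_tsupport _) (tsupport_dirD_subset ξ _))
      ((tsupport_dirD_subset ξ _).trans h3) hθ.continuousOn
  have m3 : MemLp (ξ * θ) 2 (volume.restrict Q) :=
    memLp_mul_of_tsupport_subset hQ h1.continuous h2 h3 hθ.continuousOn
  have j1 : Integrable (fun q => u q * (ξ q * dirD (stdVec i) θ q)) (volume.restrict Q) :=
    hu.integrable_mul m1
  have j2 : Integrable (fun q => u q * (dirD (stdVec i) ξ q * θ q)) (volume.restrict Q) :=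
    hu.integrable_mul m2
  have j3 : Integrable (fun q => g q i * (ξ q * θ q)) (volume.restrict Q) :=
    (hg.eval_piLp i).integrable_mul m3
  have e2 : ∫ q in Q, u q * dirD (stdVec i) (ξ * θ) q =
      (∫ q in Q, u q * (ξ q * dirD (stdVec i) θ q)) +
        ∫ q in Q, u q * (dirD (stdVec i) ξ q * θ q) := by
    rw [← integral_add j1 j2]
    refine setIntegral_congr_fun hQ.measurableSet fun q hq => ?_
    simp only [hD q hq]
    ring
  have e3 : ∫ q in Q, (θ * u) q * dirD (stdVec i) ξ q =
      ∫ q in Q, u q * (dirD (stdVec i) ξ q * θ q) := by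
    congr 1; ext q; simp only [Pi.mul_apply]; ring
  have e4 : ∫ q in Q, (θ q • g q + u q • spaceGrad θ q) i * ξ q =
      (∫ q in Q, g q i * (ξ q * θ q)) + ∫ q in Q, u q * (ξ q * dirD (stdVec i) θ q) := by
    rw [← integral_add j3 j1]
    congr 1; ext q
    simp only [PiLp.add_apply, PiLp.smul_apply, smul_eq_mul, spaceGrad_apply]
    ring
  rw [e3, e4]
  simp only [Pi.mul_apply] at e1
  linarith

lemma weakSpaceGrad_spec {u : SpaceTime d → ℝ} (h : HasL2SpaceGrad Q u) :
    MemLp (weakSpaceGrad Q u) 2 (volume.restrict Q) ∧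
      IsWeakSpaceGrad Q u (weakSpaceGrad Q u) := by
  have : weakSpaceGrad Q u = h.choose := by
    unfold weakSpaceGrad
    rw [dif_pos h]
  rw [this]
  exact h.choose_spec

lemma weakSpaceGrad_ae_eq (hQ : IsOpen Q) {u : SpaceTime d → ℝ}
    {g : SpaceTime d → EuclideanSpace ℝ (Fin d)} (hg : MemLp g 2 (volume.restrict Q))
    (h : IsWeakSpaceGrad Q u g) : weakSpaceGrad Q u =ᵐ[volume.restrict Q] g :=
  have hs := weakSpaceGrad_spec ⟨g, hg, h⟩
  IsWeakSpaceGrad.ae_eq hQ hs.1 hg hs.2 h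

lemma eLpNorm_two_sq {E : Type*} [NormedAddCommGroup E] (f : SpaceTime d → E)
    (μ : Measure (SpaceTime d)) : eLpNorm f 2 μ ^ 2 = ∫⁻ q, ‖f q‖ₑ ^ 2 ∂μ := by
  have := eLpNorm_nnreal_pow_eq_lintegral (f := f) (μ := μ) (p := 2) (by norm_num)
  simpa using this

lemma hNorm_sq_eq (hQ : IsOpen Q) {u : SpaceTime d → ℝ}
    {g : SpaceTime d → EuclideanSpace ℝ (Fin d)} (hg : MemLp g 2 (volume.restrict Q))
    (h : IsWeakSpaceGrad Q u g) :
    hNorm Q u ^ 2 = (∫⁻ q in Q, ‖u q‖ₑ ^ 2) + ∫⁻ q in Q, ‖g q‖ₑ ^ 2 := by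
  unfold hNorm
  rw [eLpNorm_congr_ae (weakSpaceGrad_ae_eq hQ hg h), eLpNorm_two_sq, eLpNorm_two_sq,
    ← ENNReal.rpow_natCast, ← ENNReal.rpow_mul]
  norm_num

end

/-! ### The Hardy inequality in `H₀` -/

section

variable {d : ℕ} {φ : SpaceTime d → ℝ} {t₀ T R : ℝ} {c : SpaceTime d}

lemma isOpen_spaceTimeDomain (hφ : ContinuousOn φ (Set.univ ×ˢ Set.Icc t₀ T)) :
    IsOpen (spaceTimeDomain φ t₀ T) := by
  have h1 : spaceTimeDomain φ t₀ T = (Set.univ ×ˢ Set.Ioo t₀ T) ∩ φ ⁻¹' Set.Iio 0 := by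
    ext q
    simp [spaceTimeDomain, Omega]
  rw [h1]
  exact (hφ.mono (Set.prod_mono_right Set.Ioo_subset_Icc_self)).isOpen_inter_preimage
    (isOpen_univ.prod isOpen_Ioo) isOpen_Iio

lemma enorm_sq_le_two_mul {E : Type*} [NormedAddCommGroup E] (a b : E) :
    ‖a‖ₑ ^ 2 ≤ 2 * (‖b‖ₑ ^ 2 + ‖a - b‖ₑ ^ 2) := by
  rw [← ofReal_norm_sq_eq_enorm, ← ofReal_norm_sq_eq_enorm, ← ofReal_norm_sq_eq_enorm,
    ← ENNReal.ofReal_add (by positivity) (by positivity),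
    show (2 : ℝ≥0∞) = ENNReal.ofReal 2 by simp, ← ENNReal.ofReal_mul (by norm_num)]
  refine ENNReal.ofReal_le_ofReal ?_
  have h1 : ‖a‖ ≤ ‖b‖ + ‖a - b‖ := by
    calc ‖a‖ = ‖b + (a - b)‖ := by rw [add_sub_cancel]
      _ ≤ _ := norm_add_le _ _
  nlinarith [sq_nonneg (‖b‖ - ‖a - b‖), norm_nonneg a, norm_nonneg b, norm_nonneg (a - b)]

lemma spaceTimeDomain_subset_closedDomain
    (hR : ∀ t ∈ Set.Icc t₀ T, ∀ x ∈ Omega φ t, ‖x‖ ≤ R) :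
    spaceTimeDomain φ t₀ T ⊆ closedDomain φ t₀ T R :=
  subDomain_subset_closedDomain hR Set.Ioo_subset_Icc_self

lemma memLp_spaceGrad_of_contDiff (hφ : ContinuousOn φ (Set.univ ×ˢ Set.Icc t₀ T))
    (hR : ∀ t ∈ Set.Icc t₀ T, ∀ x ∈ Omega φ t, ‖x‖ ≤ R) {w : SpaceTime d → ℝ}
    (hw : ContDiff ℝ ∞ w) :
    MemLp (spaceGrad w) 2 (volume.restrict (spaceTimeDomain φ t₀ T)) := by
  have hK := isCompact_closedDomain hφ R
  have hsub := spaceTimeDomain_subset_closedDomain hR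
  have hfin : IsFiniteMeasure (volume.restrict (spaceTimeDomain φ t₀ T)) :=
    ⟨by rw [Measure.restrict_apply_univ]; exact (measure_mono hsub).trans_lt hK.measure_lt_top⟩
  obtain ⟨M, hM⟩ := hK.exists_bound_of_continuousOn (continuous_spaceGrad hw).continuousOn
  refine MemLp.of_bound (continuous_spaceGrad hw).aestronglyMeasurable M ?_
  filter_upwards [ae_restrict_mem (isOpen_spaceTimeDomain hφ).measurableSet] with q hq
  exact hM q (hsub hq)

lemma tendsto_sq_zero_of_ennreal {ι : Type*} {l : Filter ι} {f : ι → ℝ≥0∞}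
    (h : Tendsto f l (𝓝 0)) : Tendsto (fun i => f i ^ 2) l (𝓝 0) := by
  have := ENNReal.Tendsto.pow (n := 2) h
  simpa using this

lemma tendsto_zero_of_sq_ennreal {ι : Type*} {l : Filter ι} {f : ι → ℝ≥0∞}
    (h : Tendsto (fun i => f i ^ 2) l (𝓝 0)) : Tendsto f l (𝓝 0) := by
  have h1 := (ENNReal.continuous_rpow_const (y := (1 / 2 : ℝ))).tendsto 0 |>.comp h
  rw [ENNReal.zero_rpow_of_pos (by norm_num)] at h1
  refine h1.congr fun i => ?_
  simp only [Function.comp_apply]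
  rw [← ENNReal.rpow_natCast, ← ENNReal.rpow_mul]
  norm_num

/-- The regularized Hardy inequality in `H₀`, with a constant independent of the
regularization. -/
lemma exists_regularized_hardy (hφ : IsLevelSetEvolution φ t₀ T c)
    (hcase : ¬ IsHoleOrVoidCase φ c) {u : SpaceTime d → ℝ} (hu : MemH₀ φ t₀ T c u) :
    ∃ D : ℝ≥0∞, D < ⊤ ∧ ∀ η : ℝ, 0 < η → ∀ κ : ℝ, 0 < κ →
      ∫⁻ q in subDomain φ (farTimes t₀ T c.2 κ),
        ENNReal.ofReal (hardyWeight φ η q) * ‖u q‖ₑ ^ 2 ≤ D := by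
  obtain ⟨R, hR⟩ := hφ.bounded
  obtain ⟨⟨hu2, hgrad⟩, w, hwc, -, hwn, hwt⟩ := hu
  set Q := spaceTimeDomain φ t₀ T with hQdef
  have hφc := hφ.smooth.continuousOn
  have hQ : IsOpen Q := isOpen_spaceTimeDomain hφc
  obtain ⟨hg2, hgw⟩ := weakSpaceGrad_spec hgrad
  set g := weakSpaceGrad Q u with hg
  obtain ⟨C, hC⟩ := exists_hardy_smooth hφ hcase hR
  set N : ℝ≥0∞ := (∫⁻ q in Q, ‖u q‖ₑ ^ 2) + ∫⁻ q in Q, ‖g q‖ₑ ^ 2 with hN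
  have hNfin : N < ⊤ := by
    rw [hN, ← eLpNorm_two_sq, ← eLpNorm_two_sq]
    exact ENNReal.add_lt_top.2 ⟨ENNReal.pow_lt_top hu2.2, ENNReal.pow_lt_top hg2.2⟩
  -- This is the limit of the bound in `hmain`, where `e n` and `Tr n` vanish. Only `C` and `N`
  -- enter, neither of which depends on `η` or `κ`.
  refine ⟨2 * (ENNReal.ofReal C * (2 * N)), ?_, fun η hη κ hκ => ?_⟩
  · exact ENNReal.mul_lt_top (by simp) (ENNReal.mul_lt_top (by simp)
      (ENNReal.mul_lt_top (by simp) hNfin))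
  obtain ⟨C', hC'⟩ := hC η hη κ hκ
  obtain ⟨B, hB⟩ := (isCompact_closedDomain hφc R).exists_bound_of_continuousOn
    (continuousOn_hardyWeight hφ.lt hφ.smooth hη)
  set I := farTimes t₀ T c.2 κ with hI
  have hIm : MeasurableSet I := measurableSet_farTimes _ _ _ _
  have hIs : I ⊆ Set.Icc t₀ T := farTimes_subset _ _ _ _
  have hm := measurableSet_subDomain hφc hIm hIs
  have hsQ : subDomain φ I ⊆ Q := fun q hq => ⟨hq.1.1, hq.2⟩
  set Tr : ℕ → ℝ≥0∞ := fun n => ∫⁻ q in spatialBoundary φ t₀ T,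
    ENNReal.ofReal (traceWeight φ t₀ T c q * w n q ^ 2) ∂(surfaceMeasure d) with hTr
  have hTr0 : Tendsto Tr atTop (𝓝 0) := by
    refine (tendsto_sq_zero_of_ennreal hwt).congr fun n => ?_
    unfold traceNorm
    rw [← ENNReal.rpow_natCast, ← ENNReal.rpow_mul]
    norm_num [hTr]
  set e : ℕ → ℝ≥0∞ := fun n => hNorm Q (u - w n) ^ 2 with he
  have he0 : Tendsto e atTop (𝓝 0) := tendsto_sq_zero_of_ennreal hwn
  -- Split `u² ≤ 2(w_n² + (u - w_n)²)`. The smooth Hardy inequality handles `w_n`. For the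
  -- difference, the weight is bounded by `B` at fixed `η`.
  have hmain : ∀ n, ∫⁻ q in subDomain φ I, ENNReal.ofReal (hardyWeight φ η q) * ‖u q‖ₑ ^ 2 ≤
      2 * ((ENNReal.ofReal C * (2 * (N + e n)) + ENNReal.ofReal C' * Tr n) +
        ENNReal.ofReal B * e n) := by
    intro n
    have hw2 : MemLp (w n) 2 (volume.restrict Q) := by
      have hK := isCompact_closedDomain hφc R
      have hsub := spaceTimeDomain_subset_closedDomain hR
      have hfin : IsFiniteMeasure (volume.restrict Q) :=
        ⟨by rw [Measure.restrict_apply_univ]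
            exact (measure_mono hsub).trans_lt hK.measure_lt_top⟩
      obtain ⟨M, hM⟩ := hK.exists_bound_of_continuousOn (hwc n).continuous.continuousOn
      refine MemLp.of_bound (hwc n).continuous.aestronglyMeasurable M ?_
      filter_upwards [ae_restrict_mem hQ.measurableSet] with q hq
      exact hM q (hsub hq)
    have hgw2 := memLp_spaceGrad_of_contDiff hφc hR (hwc n)
    have hen : e n = (∫⁻ q in Q, ‖(u - w n) q‖ₑ ^ 2) + ∫⁻ q in Q, ‖(g - spaceGrad (w n)) q‖ₑ ^ 2 :=
      hNorm_sq_eq hQ (hg2.sub hgw2)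
        (IsWeakSpaceGrad.sub hu2 hw2 hg2 hgw2 hgw (isWeakSpaceGrad_of_contDiff (hwc n)))
    have mu : AEMeasurable (fun q => ‖u q‖ₑ ^ 2) (volume.restrict Q) :=
      hu2.1.enorm.pow_const 2
    have muw : AEMeasurable (fun q => ‖(u - w n) q‖ₑ ^ 2) (volume.restrict Q) :=
      (hu2.sub hw2).1.enorm.pow_const 2
    have s1 : ∫⁻ q in Q, (‖w n q‖ₑ ^ 2 + ‖spaceGrad (w n) q‖ₑ ^ 2) ≤ 2 * (N + e n) := by
      have p1 : ∀ q, ‖w n q‖ₑ ^ 2 + ‖spaceGrad (w n) q‖ₑ ^ 2 ≤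
          2 * ((‖u q‖ₑ ^ 2 + ‖(u - w n) q‖ₑ ^ 2) +
            (‖g q‖ₑ ^ 2 + ‖(g - spaceGrad (w n)) q‖ₑ ^ 2)) := by
        intro q
        have a1 := enorm_sq_le_two_mul (w n q) (u q)
        have a2 := enorm_sq_le_two_mul (spaceGrad (w n) q) (g q)
        rw [enorm_sub_rev] at a1 a2
        rw [mul_add]
        exact add_le_add a1 a2
      refine (lintegral_mono p1).trans (le_of_eq ?_)
      have muuw : AEMeasurable (fun q => ‖u q‖ₑ ^ 2 + ‖(u - w n) q‖ₑ ^ 2) (volume.restrict Q) :=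
        mu.add muw
      rw [lintegral_const_mul' _ _ (by simp), lintegral_add_left' muuw,
        lintegral_add_left' mu, lintegral_add_left' (hg2.1.enorm.pow_const 2), hen, hN]
      ring
    have s2 : ∫⁻ q in subDomain φ I, ENNReal.ofReal (hardyWeight φ η q) * ‖u q‖ₑ ^ 2 ≤
        ∫⁻ q in subDomain φ I, 2 * (ENNReal.ofReal (hardyWeight φ η q) * ‖w n q‖ₑ ^ 2 +
          ENNReal.ofReal B * ‖(u - w n) q‖ₑ ^ 2) := by
      refine setLIntegral_mono' hm fun q hq => ?_
      calc ENNReal.ofReal (hardyWeight φ η q) * ‖u q‖ₑ ^ 2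
          ≤ ENNReal.ofReal (hardyWeight φ η q) * (2 * (‖w n q‖ₑ ^ 2 + ‖u q - w n q‖ₑ ^ 2)) := by
            gcongr; exact enorm_sq_le_two_mul _ _
        _ = 2 * (ENNReal.ofReal (hardyWeight φ η q) * ‖w n q‖ₑ ^ 2 +
              ENNReal.ofReal (hardyWeight φ η q) * ‖(u - w n) q‖ₑ ^ 2) := by
            rw [Pi.sub_apply]; ring
        _ ≤ _ := by
            have : hardyWeight φ η q ≤ B :=
              (le_abs_self _).trans (hB q (spaceTimeDomain_subset_closedDomain hR (hsQ hq)))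
            gcongr
    refine s2.trans ?_
    rw [lintegral_const_mul' _ _ (by simp), lintegral_add_right' _
      ((muw.mono_set hsQ).const_mul _), lintegral_const_mul' _ _ ENNReal.ofReal_ne_top]
    refine mul_le_mul' le_rfl (add_le_add ?_ (mul_le_mul' le_rfl ?_))
    · exact (hC' (w n) (hwc n)).trans (add_le_add (mul_le_mul' le_rfl s1) le_rfl)
    · rw [hen]
      exact (lintegral_mono_set hsQ).trans le_self_add
  -- In the limit `n → ∞` the constants `B` and `C'`, which may blow up with `η` or `κ`, multiply
  -- quantities tending to zero.
  refine ge_of_tendsto' (x := atTop) ?_ hmain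
  have l1 : Tendsto (fun n => N + e n) atTop (𝓝 (N + 0)) := tendsto_const_nhds.add he0
  have l2 := ENNReal.Tendsto.const_mul (a := 2) l1 (Or.inr (by simp))
  have l3 := ENNReal.Tendsto.const_mul (a := ENNReal.ofReal C) l2 (Or.inr (by simp))
  have l4 := ENNReal.Tendsto.const_mul (a := ENNReal.ofReal C') hTr0 (Or.inr (by simp))
  have l5 := ENNReal.Tendsto.const_mul (a := ENNReal.ofReal B) he0 (Or.inr (by simp))
  have l6 := ENNReal.Tendsto.const_mul (a := 2) ((l3.add l4).add l5) (Or.inr (by simp))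
  simpa using l6

/-- The Hardy inequality in `H₀`: `u ∇φ / φ` is square integrable. -/
lemma lintegral_hardyWeight_lt_top (hφ : IsLevelSetEvolution φ t₀ T c)
    (hcase : ¬ IsHoleOrVoidCase φ c) {u : SpaceTime d → ℝ} (hu : MemH₀ φ t₀ T c u) :
    ∫⁻ q in spaceTimeDomain φ t₀ T, ENNReal.ofReal (hardyWeight φ 0 q) * ‖u q‖ₑ ^ 2 < ⊤ := by
  obtain ⟨D, hD, hDle⟩ := exists_regularized_hardy hφ hcase hu
  obtain ⟨R, hR⟩ := hφ.bounded
  have hφc := hφ.smooth.continuousOn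
  set Q := spaceTimeDomain φ t₀ T with hQdef
  have hQ : IsOpen Q := isOpen_spaceTimeDomain hφc
  have hm : ∀ κ, MeasurableSet (subDomain φ (farTimes t₀ T c.2 κ)) := fun κ =>
    measurableSet_subDomain hφc (measurableSet_farTimes _ _ _ _) (farTimes_subset _ _ _ _)
  -- One parameter plays both roles, regularization `η` and distance `κ` from the critical time.
  set F : ℝ → SpaceTime d → ℝ≥0∞ := fun η => (subDomain φ (farTimes t₀ T c.2 η)).indicator
    fun q => ENNReal.ofReal (hardyWeight φ η q) * ‖u q‖ₑ ^ 2 with hF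
  set r : ℕ → ℝ := fun n => 1 / ((n : ℝ) + 1) with hr
  have hr0 : ∀ n, 0 < r n := fun n => by positivity
  have hrlim : Tendsto r atTop (𝓝 0) := tendsto_one_div_add_atTop_nhds_zero_nat
  have hFm : ∀ n, AEMeasurable (F (r n)) (volume.restrict Q) := by
    intro n
    refine AEMeasurable.indicator ?_ (hm _)
    refine AEMeasurable.mul ?_ (hu.1.1.1.enorm.pow_const 2)
    exact (((continuousOn_hardyWeight hφ.lt hφ.smooth (hr0 n)).mono
      (spaceTimeDomain_subset_closedDomain hR)).aemeasurable hQ.measurableSet).ennreal_ofReal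
  -- The critical time slice is a null set. Every other point of `𝒬` eventually enters the retained
  -- time set.
  have hne : ∀ᵐ q ∂(volume.restrict Q), q.2 ≠ c.2 := by
    refine ae_restrict_of_ae ?_
    have : (volume : Measure (SpaceTime d)) (Set.univ ×ˢ {c.2}) = 0 := by
      rw [Measure.volume_eq_prod, Measure.prod_prod]; simp
    rw [ae_iff]
    convert this using 2
    ext q
    simp
  have hlim : ∀ᵐ q ∂(volume.restrict Q), ENNReal.ofReal (hardyWeight φ 0 q) * ‖u q‖ₑ ^ 2 ≤
      liminf (fun n => F (r n) q) atTop := by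
    filter_upwards [hne, ae_restrict_mem hQ.measurableSet] with q hq hqQ
    have hpos : 0 < |q.2 - c.2| := abs_pos.2 (sub_ne_zero.2 hq)
    have hφq : φ q < 0 := hqQ.2
    have h1 : ∀ᶠ n in atTop, ENNReal.ofReal (hardyWeight φ (r n) q) * ‖u q‖ₑ ^ 2 = F (r n) q := by
      filter_upwards [hrlim.eventually (gt_mem_nhds hpos)] with n hn
      have hmem : q ∈ subDomain φ (farTimes t₀ T c.2 (r n)) := ⟨⟨hqQ.1, hn.le⟩, hqQ.2⟩
      simp only [hF, Set.indicator_of_mem hmem]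
    have h2 : Tendsto (fun n => hardyWeight φ (r n) q) atTop (𝓝 (hardyWeight φ 0 q)) := by
      unfold hardyWeight
      have : (0 : ℝ) - φ q ≠ 0 := by linarith
      exact (((hrlim.sub_const (φ q)).inv₀ this).pow 2).const_mul _
    have h3 := ENNReal.Tendsto.mul_const (b := ‖u q‖ₑ ^ 2)
      (ENNReal.tendsto_ofReal h2) (Or.inr (by simp))
    exact ((h3.congr' h1).liminf_eq).ge
  refine lt_of_le_of_lt ?_ hD
  refine (lintegral_mono_ae hlim).trans ((lintegral_liminf_le' hFm).trans ?_)
  refine liminf_le_of_frequently_le (Frequently.of_forall fun n => ?_) (by isBoundedDefault)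
  rw [hF]
  simp only
  rw [setLIntegral_indicator (hm _)]
  exact (lintegral_mono_set Set.inter_subset_left).trans (hDle _ (hr0 n) _ (hr0 n))

end

/-! ### The level-set cut-off and dominated convergence -/

section

variable {d : ℕ} {φ : SpaceTime d → ℝ} {t₀ T : ℝ} {c : SpaceTime d} {h : ℝ → ℝ}

lemma IsCutoffProfile.contDiffAt (hh : IsCutoffProfile h) {r : ℝ} (hr : 0 < r) :
    ContDiffAt ℝ ∞ h r := hh.smooth.contDiffAt (Ici_mem_nhds hr)

lemma IsCutoffProfile.abs_deriv_le_one (hh : IsCutoffProfile h) {r : ℝ} (hr : 0 < r) :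
    |deriv h r| ≤ 1 := by
  rw [← derivWithin_of_mem_nhds (Ici_mem_nhds hr)]
  exact hh.abs_deriv_le r hr.le

lemma IsCutoffProfile.deriv_eq_zero (hh : IsCutoffProfile h) {r : ℝ} (hr : 3 < r) :
    deriv h r = 0 := by
  have : h =ᶠ[𝓝 r] fun _ => 1 := by
    filter_upwards [lt_mem_nhds hr] with s hs
    exact hh.eq_one s hs.le
  rw [this.deriv_eq]
  simp

lemma contDiffAt_of_mem_spaceTimeDomain (hφ : ContDiffOn ℝ ∞ φ (Set.univ ×ˢ Set.Icc t₀ T))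
    {q : SpaceTime d} (hq : q ∈ spaceTimeDomain φ t₀ T) : ContDiffAt ℝ ∞ φ q :=
  hφ.contDiffAt (prod_mem_nhds univ_mem (Icc_mem_nhds hq.1.1 hq.1.2))

lemma neg_div_pos_of_mem {ε : ℝ} (hε : 0 < ε) {q : SpaceTime d}
    (hq : q ∈ spaceTimeDomain φ t₀ T) : 0 < -φ q / ε :=
  div_pos (neg_pos.2 hq.2) hε

lemma contDiffOn_theta (hφ : ContDiffOn ℝ ∞ φ (Set.univ ×ˢ Set.Icc t₀ T))
    (hh : IsCutoffProfile h) {ε : ℝ} (hε : 0 < ε) :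
    ContDiffOn ℝ ∞ (theta h φ ε) (spaceTimeDomain φ t₀ T) := by
  intro q hq
  have h1 := (contDiffAt_of_mem_spaceTimeDomain hφ hq).neg.div_const ε
  exact (ContDiffAt.comp q (hh.contDiffAt (neg_div_pos_of_mem hε hq)) h1).contDiffWithinAt

lemma spaceGrad_theta (hφ : ContDiffOn ℝ ∞ φ (Set.univ ×ˢ Set.Icc t₀ T))
    (hh : IsCutoffProfile h) {ε : ℝ} (hε : 0 < ε) {q : SpaceTime d}
    (hq : q ∈ spaceTimeDomain φ t₀ T) :
    spaceGrad (theta h φ ε) q = (-(deriv h (-φ q / ε)) / ε) • spaceGrad φ q := by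
  ext i
  rw [PiLp.smul_apply, spaceGrad_apply, spaceGrad_apply, smul_eq_mul]
  have h1 : HasLineDerivAt ℝ φ (dirD (stdVec i) φ q) q (stdVec i, 0) :=
    hasLineDerivAt_dirD (differentiableAt_slice
      ((contDiffAt_of_mem_spaceTimeDomain hφ hq).differentiableAt (by simp))) _
  have h2 : HasLineDerivAt ℝ (theta h φ ε) (dirD (stdVec i) (theta h φ ε) q) q (stdVec i, 0) :=
    hasLineDerivAt_dirD (differentiableAt_slice
      (((contDiffOn_theta hφ hh hε).contDiffAt
        ((isOpen_spaceTimeDomain hφ.continuousOn).mem_nhds hq)).differentiableAt (by simp))) _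
  have h3 : HasDerivAt h (deriv h (-φ q / ε)) (-φ q / ε) :=
    ((hh.contDiffAt (neg_div_pos_of_mem hε hq)).differentiableAt (by simp)).hasDerivAt
  have h4 : HasDerivAt (fun τ : ℝ => theta h φ ε (q + τ • (stdVec i, 0)))
      (deriv h (-φ q / ε) * (-dirD (stdVec i) φ q / ε)) 0 := by
    refine HasDerivAt.comp (0 : ℝ) (h₂ := h)
      (h := fun τ : ℝ => -φ (q + τ • (stdVec i, 0)) / ε) ?_ (HasDerivAt.neg h1 |>.div_const ε)
    simpa using h3
  rw [HasDerivAt.unique h2 h4]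
  ring

/-- Where `h'(-φ/ε) ≠ 0` one has `-φ ≤ 3ε`, hence `1/ε ≤ 3/(-φ)`. The square of this `3` is the
constant `9`, and the bound no longer involves `ε`. -/
lemma enorm_smul_spaceGrad_theta_sq_le (hφ : ContDiffOn ℝ ∞ φ (Set.univ ×ˢ Set.Icc t₀ T))
    (hh : IsCutoffProfile h) {ε : ℝ} (hε : 0 < ε) {q : SpaceTime d}
    (hq : q ∈ spaceTimeDomain φ t₀ T) (a : ℝ) :
    ‖a • spaceGrad (theta h φ ε) q‖ₑ ^ 2 ≤
      9 * (ENNReal.ofReal (hardyWeight φ 0 q) * ‖a‖ₑ ^ 2) := by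
  have hφq : 0 < -φ q := neg_pos.2 hq.2
  have h1 : |deriv h (-φ q / ε)| / ε ≤ 3 * (-φ q)⁻¹ := by
    by_cases hr : 3 < -φ q / ε
    · rw [hh.deriv_eq_zero hr]
      simp only [abs_zero, zero_div]
      positivity
    · push Not at hr
      rw [div_le_iff₀ hε] at hr
      rw [← div_eq_mul_inv, div_le_div_iff₀ hε hφq]
      have := hh.abs_deriv_le_one (neg_div_pos_of_mem hε hq)
      nlinarith [abs_nonneg (deriv h (-φ q / ε))]
  rw [← ofReal_norm_sq_eq_enorm, ← ofReal_sq_eq_enorm,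
    ← ENNReal.ofReal_mul (hardyWeight_nonneg _ _ _), show (9 : ℝ≥0∞) = ENNReal.ofReal 9 by simp,
    ← ENNReal.ofReal_mul (by norm_num)]
  refine ENNReal.ofReal_le_ofReal ?_
  rw [spaceGrad_theta hφ hh hε hq, norm_smul, norm_smul, Real.norm_eq_abs, Real.norm_eq_abs,
    abs_div, abs_neg, abs_of_pos hε]
  unfold hardyWeight
  have h2 : (|deriv h (-φ q / ε)| / ε) ^ 2 ≤ (3 * (-φ q)⁻¹) ^ 2 := by
    have : 0 ≤ |deriv h (-φ q / ε)| / ε := by positivity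
    gcongr
  calc (|a| * (|deriv h (-φ q / ε)| / ε * ‖spaceGrad φ q‖)) ^ 2
      = (|a| * ‖spaceGrad φ q‖) ^ 2 * (|deriv h (-φ q / ε)| / ε) ^ 2 := by ring
    _ ≤ (|a| * ‖spaceGrad φ q‖) ^ 2 * (3 * (-φ q)⁻¹) ^ 2 := by gcongr
    _ = _ := by rw [mul_pow, sq_abs, zero_sub]; ring

lemma aestronglyMeasurable_smul_spaceGrad_theta
    (hφ : ContDiffOn ℝ ∞ φ (Set.univ ×ˢ Set.Icc t₀ T))
    (hh : IsCutoffProfile h) {ε : ℝ} (hε : 0 < ε) {u : SpaceTime d → ℝ}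
    (hu : AEStronglyMeasurable u (volume.restrict (spaceTimeDomain φ t₀ T))) :
    AEStronglyMeasurable (fun q => u q • spaceGrad (theta h φ ε) q)
      (volume.restrict (spaceTimeDomain φ t₀ T)) := by
  have hQ := isOpen_spaceTimeDomain hφ.continuousOn
  refine hu.smul (ContinuousOn.aestronglyMeasurable ?_ hQ.measurableSet)
  have : spaceGrad (theta h φ ε) =
      fun q => WithLp.toLp 2 (fun i => dirD (stdVec i) (theta h φ ε) q) := by
    ext q; rw [spaceGrad_eq_toLp]
  rw [this]
  exact (PiLp.continuous_toLp 2 _).comp_continuousOn (continuousOn_pi.2 fun i =>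
    continuousOn_dirD hQ (contDiffOn_theta hφ hh hε) _)

/-- Dominated convergence along a countably generated filter, for a.e. measurable functions. -/
lemma tendsto_lintegral_zero_of_dominated {α ι : Type*} [MeasurableSpace α] {μ : Measure α}
    {l : Filter ι} [l.IsCountablyGenerated] {F : ι → α → ℝ≥0∞} (bound : α → ℝ≥0∞)
    (hF : ∀ᶠ n in l, AEMeasurable (F n) μ) (hb : ∀ᶠ n in l, ∀ᵐ a ∂μ, F n a ≤ bound a)
    (hfin : ∫⁻ a, bound a ∂μ ≠ ⊤) (hlim : ∀ᵐ a ∂μ, Tendsto (fun n => F n a) l (𝓝 0)) :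
    Tendsto (fun n => ∫⁻ a, F n a ∂μ) l (𝓝 0) := by
  -- Along a sequence the hypotheses hold only from some index `k` on, so the sequence is shifted by
  -- `k`.
  refine tendsto_of_seq_tendsto fun x hx => ?_
  obtain ⟨k, hk⟩ := eventually_atTop.1 (hx.eventually (hF.and hb))
  rw [← tendsto_add_atTop_iff_nat k]
  have key := tendsto_lintegral_of_dominated_convergence' (μ := μ)
    (F := fun n a => F (x (n + k)) a) (f := fun _ => 0) bound
    (fun n => (hk (n + k) (by omega)).1) (fun n => (hk (n + k) (by omega)).2) hfin (by
      filter_upwards [hlim] with a ha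
      exact (ha.comp hx).comp (tendsto_add_atTop_nat k))
  simpa using key

lemma tendsto_lintegral_smul_spaceGrad_theta (hφ : IsLevelSetEvolution φ t₀ T c)
    (hcase : ¬ IsHoleOrVoidCase φ c) (hh : IsCutoffProfile h) {u : SpaceTime d → ℝ}
    (hu : MemH₀ φ t₀ T c u) :
    Tendsto (fun ε : ℝ => ∫⁻ q in spaceTimeDomain φ t₀ T,
      ‖u q • spaceGrad (theta h φ ε) q‖ₑ ^ 2) (𝓝[>] 0) (𝓝 0) := by
  have hQ := isOpen_spaceTimeDomain hφ.smooth.continuousOn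
  refine tendsto_lintegral_zero_of_dominated
    (fun q => 9 * (ENNReal.ofReal (hardyWeight φ 0 q) * ‖u q‖ₑ ^ 2)) ?_ ?_ ?_ ?_
  · filter_upwards [self_mem_nhdsWithin] with ε hε
    exact (aestronglyMeasurable_smul_spaceGrad_theta hφ.smooth hh hε hu.1.1.1).enorm.pow_const 2
  · filter_upwards [self_mem_nhdsWithin] with ε hε
    filter_upwards [ae_restrict_mem hQ.measurableSet] with q hq
    exact enorm_smul_spaceGrad_theta_sq_le hφ.smooth hh hε hq _
  · rw [lintegral_const_mul' _ _ (by simp)]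
    exact ENNReal.mul_ne_top (by simp) (lintegral_hardyWeight_lt_top hφ hcase hu).ne
  · filter_upwards [ae_restrict_mem hQ.measurableSet] with q hq
    have hφq : 0 < -φ q := neg_pos.2 hq.2
    refine tendsto_const_nhds.congr' ?_
    filter_upwards [self_mem_nhdsWithin,
      nhdsWithin_le_nhds (gt_mem_nhds (show 0 < -φ q / 3 by positivity))] with ε hε hε'
    have hε0 : (0 : ℝ) < ε := hε
    rw [spaceGrad_theta hφ.smooth hh hε0 hq, hh.deriv_eq_zero (by rw [lt_div_iff₀ hε0]; linarith)]
    simp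

lemma tendsto_lintegral_one_sub_theta_smul {E : Type*} [NormedAddCommGroup E] [NormedSpace ℝ E]
    (hφ : IsLevelSetEvolution φ t₀ T c) (hh : IsCutoffProfile h) {f : SpaceTime d → E}
    (hf : MemLp f 2 (volume.restrict (spaceTimeDomain φ t₀ T))) :
    Tendsto (fun ε : ℝ => ∫⁻ q in spaceTimeDomain φ t₀ T,
      ‖(1 - theta h φ ε q) • f q‖ₑ ^ 2) (𝓝[>] 0) (𝓝 0) := by
  have hQ := isOpen_spaceTimeDomain hφ.smooth.continuousOn
  refine tendsto_lintegral_zero_of_dominated (fun q => ‖f q‖ₑ ^ 2) ?_ ?_ ?_ ?_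
  · filter_upwards [self_mem_nhdsWithin] with ε hε
    have h1 : ContinuousOn (fun q => 1 - theta h φ ε q) (spaceTimeDomain φ t₀ T) :=
      continuousOn_const.sub (contDiffOn_theta hφ.smooth hh hε).continuousOn
    exact ((h1.aestronglyMeasurable hQ.measurableSet).smul hf.1).enorm.pow_const 2
  · filter_upwards [self_mem_nhdsWithin] with ε hε
    filter_upwards [ae_restrict_mem hQ.measurableSet] with q hq
    have h1 := hh.mem_Icc _ (neg_div_pos_of_mem hε hq).le
    have h2 : ‖(1 - theta h φ ε q) • f q‖ₑ ≤ ‖f q‖ₑ := by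
      rw [enorm_le_iff_norm_le, norm_smul, Real.norm_eq_abs]
      refine mul_le_of_le_one_left (norm_nonneg _) ?_
      unfold theta
      rw [abs_le]
      constructor <;> linarith [h1.1, h1.2]
    gcongr
  · rw [← eLpNorm_two_sq]
    exact (ENNReal.pow_lt_top hf.2).ne
  · filter_upwards [ae_restrict_mem hQ.measurableSet] with q hq
    have hφq : 0 < -φ q := neg_pos.2 hq.2
    refine tendsto_const_nhds.congr' ?_
    filter_upwards [self_mem_nhdsWithin,
      nhdsWithin_le_nhds (gt_mem_nhds (show 0 < -φ q / 3 by positivity))] with ε hε hε'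
    have hε0 : (0 : ℝ) < ε := hε
    have : theta h φ ε q = 1 := hh.eq_one _ (by
      rw [Set.mem_Ici, le_div_iff₀ hε0]; linarith)
    rw [this]
    simp

end

end EvolvingDomain

/-! ### Convergence of the cut-off functions -/

open EvolvingDomain in
theorem mainTheorem6 {d : ℕ} (hd : d = 2 ∨ d = 3)
    (φ : EvolvingDomain.SpaceTime d → ℝ) (t₀ T : ℝ) (c : EvolvingDomain.SpaceTime d)
    (hφ : EvolvingDomain.IsLevelSetEvolution φ t₀ T c)
    (hcase : ¬ EvolvingDomain.IsHoleOrVoidCase φ c)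
    (h : ℝ → ℝ) (hh : EvolvingDomain.IsCutoffProfile h)
    (u : EvolvingDomain.SpaceTime d → ℝ) (hu : EvolvingDomain.MemH₀ φ t₀ T c u) :
    (∀ ε : ℝ, 0 < ε →
      EvolvingDomain.MemH (EvolvingDomain.spaceTimeDomain φ t₀ T)
        (EvolvingDomain.theta h φ ε * u)) ∧
    Tendsto (fun ε : ℝ => EvolvingDomain.hNorm (EvolvingDomain.spaceTimeDomain φ t₀ T)
        (u - EvolvingDomain.theta h φ ε * u)) (𝓝[>] 0) (𝓝 0) ∧
    Tendsto (fun ε : ℝ =>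
        eLpNorm (fun q => u q • EvolvingDomain.spaceGrad (EvolvingDomain.theta h φ ε) q) 2
          (volume.restrict (EvolvingDomain.spaceTimeDomain φ t₀ T))) (𝓝[>] 0) (𝓝 0) := by
  have hQ := isOpen_spaceTimeDomain hφ.smooth.continuousOn
  have hu2 := hu.1.1
  obtain ⟨hg2, hgw⟩ := weakSpaceGrad_spec hu.1.2
  set Q := spaceTimeDomain φ t₀ T with hQdef
  set g := weakSpaceGrad Q u with hg
  have hθc : ∀ ε : ℝ, 0 < ε → ContDiffOn ℝ ∞ (theta h φ ε) Q := fun ε hε =>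
    contDiffOn_theta hφ.smooth hh hε
  have hθm : ∀ ε : ℝ, 0 < ε → AEStronglyMeasurable (theta h φ ε) (volume.restrict Q) :=
    fun ε hε => (hθc ε hε).continuousOn.aestronglyMeasurable hQ.measurableSet
  have hθ1 : ∀ ε : ℝ, 0 < ε → ∀ q ∈ Q, ‖theta h φ ε q‖ ≤ 1 := by
    intro ε hε q hq
    have h1 := hh.mem_Icc _ (neg_div_pos_of_mem hε hq).le
    rw [Real.norm_eq_abs, abs_le]
    exact ⟨by linarith [h1.1, show theta h φ ε q = h (-φ q / ε) from rfl], h1.2⟩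
  have hθu : ∀ ε : ℝ, 0 < ε → MemLp (theta h φ ε * u) 2 (volume.restrict Q) := by
    intro ε hε
    refine hu2.of_le ((hθm ε hε).mul hu2.1) ?_
    filter_upwards [ae_restrict_mem hQ.measurableSet] with q hq
    rw [Pi.mul_apply, norm_mul]
    exact mul_le_of_le_one_left (norm_nonneg _) (hθ1 ε hε q hq)
  have hθg : ∀ ε : ℝ, 0 < ε → MemLp (fun q => theta h φ ε q • g q) 2 (volume.restrict Q) := by
    intro ε hε
    refine hg2.of_le ((hθm ε hε).smul hg2.1) ?_
    filter_upwards [ae_restrict_mem hQ.measurableSet] with q hq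
    rw [norm_smul]
    exact mul_le_of_le_one_left (norm_nonneg _) (hθ1 ε hε q hq)
  have hD : ∀ ε : ℝ, 0 < ε →
      MemLp (fun q => u q • spaceGrad (theta h φ ε) q) 2 (volume.restrict Q) := by
    intro ε hε
    refine ⟨aestronglyMeasurable_smul_spaceGrad_theta hφ.smooth hh hε hu2.1, ?_⟩
    -- Square integrability of `u ∇θ_ε` is already a consequence of the Hardy inequality. For
    -- general `u ∈ L²` it could fail, since `∇φ` is not assumed bounded on all of space-time; here
    -- the common majorant suffices.
    have h1 : eLpNorm (fun q => u q • spaceGrad (theta h φ ε) q) 2 (volume.restrict Q) ^ 2 < ⊤ := by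
      rw [eLpNorm_two_sq]
      refine (setLIntegral_mono' hQ.measurableSet fun q hq =>
        enorm_smul_spaceGrad_theta_sq_le hφ.smooth hh hε hq _).trans_lt ?_
      rw [lintegral_const_mul' _ _ (by simp)]
      exact ENNReal.mul_lt_top (by simp) (lintegral_hardyWeight_lt_top hφ hcase hu)
    exact (ENNReal.pow_lt_top_iff.1 h1).resolve_right (by norm_num)
  have hG : ∀ ε : ℝ, 0 < ε → MemLp
      (fun q => theta h φ ε q • g q + u q • spaceGrad (theta h φ ε) q) 2 (volume.restrict Q) :=
    fun ε hε => (hθg ε hε).add (hD ε hε)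
  have hGw : ∀ ε : ℝ, 0 < ε → IsWeakSpaceGrad Q (theta h φ ε * u)
      (fun q => theta h φ ε q • g q + u q • spaceGrad (theta h φ ε) q) := fun ε hε =>
    hgw.smooth_mul hQ hu2 hg2 (hθc ε hε)
  have hlimD := tendsto_lintegral_smul_spaceGrad_theta hφ hcase hh hu
  refine ⟨fun ε hε => ⟨hθu ε hε, _, hG ε hε, hGw ε hε⟩, ?_, ?_⟩
  · refine tendsto_zero_of_sq_ennreal ?_
    have l1 := tendsto_lintegral_one_sub_theta_smul hφ hh hu2
    have l2 := tendsto_lintegral_one_sub_theta_smul hφ hh hg2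
    have l3 := l1.add (ENNReal.Tendsto.const_mul (a := 2) (hlimD.add l2) (Or.inr (by simp)))
    simp only [add_zero, mul_zero] at l3
    refine tendsto_of_tendsto_of_tendsto_of_le_of_le' tendsto_const_nhds l3
      (Eventually.of_forall fun _ => zero_le) ?_
    filter_upwards [self_mem_nhdsWithin] with ε hε
    have hε0 : (0 : ℝ) < ε := hε
    rw [hNorm_sq_eq hQ (hg2.sub (hG ε hε0))
      (hgw.sub hu2 (hθu ε hε0) hg2 (hG ε hε0) (hGw ε hε0))]
    refine add_le_add (le_of_eq (lintegral_congr fun q => ?_)) ?_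
    · rw [Pi.sub_apply, Pi.mul_apply, smul_eq_mul, sub_mul, one_mul]
    · rw [← lintegral_add_left' ((hD ε hε0).1.enorm.pow_const 2),
        ← lintegral_const_mul' _ _ (by simp)]
      refine lintegral_mono fun q => ?_
      -- The gradient of `u - θ_ε u` is `(1 - θ_ε) g - u ∇θ_ε`. It is compared with `-u ∇θ_ε`, so
      -- that the difference is exactly `(1 - θ_ε) g`.
      have := enorm_sq_le_two_mul
        ((g - fun q => theta h φ ε q • g q + u q • spaceGrad (theta h φ ε) q) q)
        (-(u q • spaceGrad (theta h φ ε) q))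
      refine this.trans (le_of_eq ?_)
      rw [enorm_neg, Pi.sub_apply]
      congr 4
      module
  · refine tendsto_zero_of_sq_ennreal ?_
    simp only [eLpNorm_two_sq]
    exact hlimD
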